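/- Let $m\in\mathbb{N}$ and let $\chi$ be a real, primitive, non-principal Dirichlet character modulo $m$. Let $a=0$ if $\chi(-1)=1$ and $a=1$ if $\chi(-1)=-1$. Put $$\phi(t,\chi)=\sum_{n=-\infty}^{\infty}n^{a}\chi(n)\exp\left(-\frac{n^{2}\pi}{me^{2t}}-\frac{1+2a}{2}t\right),\qquad t\in\mathbb{R},$$ with $n^0=1$ for all $n$, and let $\Xi(z,\chi)$ be the entire function $$\Xi(z,\chi)=\left(\frac{\pi}{m}\right)^{-(1+2a+2iz)/4}\Gamma\left(\frac{1+2a+2iz}{4}\right)L\left(\frac{1+2iz}{2},\chi\right)$$ (the poles of the Gamma factor being removable singularities of the product). Assume that $\phi(t,\chi)\ge 0$ for all $t\in\mathbb{R}$. Then the generalized Riemann hypothesis holds for $L(s,\chi)$ (every zero of $L(s,\chi)$ with $0<\Re s<1$ satisfies $\Re s=\frac12$) if and only if there is a real number $\rho$ with $$0<\rho\le\inf\left\{|z| : z\in\mathbb{C},\ \Xi(z,\chi)=0\right\}$$ such that for all integers $j,k\ge 0$ $$\frac{\partial^{j+k}}{\partial z^{j+k}}\left\{(z-1)^{j}\,\frac{\Xi'(\rho\sqrt{z},\chi)}{\sqrt{z}\,\Xi(\rho\sqrt{z},\chi)}\right\}\bigg|_{z=0}\le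 0,$$ where the quotient, which does not depend on the choice of the square root because $\Xi(\cdot,\chi)$ is even, is extended analytically to $z=0$, and "$\le 0$" means that the number is real and at most $0$. -/

import Mathlib

open scoped ComplexOrder Topology

namespace CharacterXi

/-- A real Dirichlet character: all its values are real numbers. -/
def IsRealCharacter {m : ℕ} (χ : DirichletCharacter ℂ m) : Prop :=
  ∀ n : ZMod m, (χ n).im = 0

open Classical in
/-- The parity of a character: `0` if `χ (-1) = 1`, and `1` if `χ (-1) = -1`. -/
noncomputable def parity {m : ℕ} (χ : DirichletCharacter ℂ m) : ℕ :=
  if χ (-1) = 1 then 0 else 1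

/-- The kernel
`φ(t, χ) = ∑_{n ∈ ℤ} n ^ a * χ(n) * exp (-n ^ 2 * π / (m * e ^ (2 t)) - (1 + 2 a) * t / 2)`,
where `a` is the parity of `χ`. It is complex-valued here; `0 ≤ phi χ t` in the order of `ℂ` says
that the value is real and nonnegative. -/
noncomputable def phi {m : ℕ} (χ : DirichletCharacter ℂ m) (t : ℝ) : ℂ :=
  ∑' n : ℤ, (n : ℂ) ^ parity χ * χ (n : ZMod m) *
    (Real.exp (-((n : ℝ) ^ 2 * Real.pi / (m * Real.exp (2 * t)))
      - (1 + 2 * (parity χ : ℝ)) / 2 * t) : ℂ)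

/-- The entire function `Ξ(z, χ)`: with `s = 1 / 2 + i z` it is `m ^ ((s + a) / 2) * Λ(s, χ)`,
where Mathlib's completed L-function `Λ(s, χ)` is the analytic continuation of
`π ^ (-(s + a) / 2) * Γ((s + a) / 2) * L(s, χ)`. The theorem `Xi_eq` is the usual formula, off the
poles of the Gamma factor. -/
noncomputable def Xi {m : ℕ} [NeZero m] (χ : DirichletCharacter ℂ m) (z : ℂ) : ℂ :=
  (m : ℂ) ^ ((1 + 2 * (parity χ : ℂ) + 2 * Complex.I * z) / 4) *
    χ.completedLFunction ((1 + 2 * Complex.I * z) / 2)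

theorem Xi_eq {m : ℕ} [NeZero m] (χ : DirichletCharacter ℂ m) (hχ : χ ≠ 1) (z : ℂ)
    (hz : ∀ n : ℕ, (1 + 2 * (parity χ : ℂ) + 2 * Complex.I * z) / 4 ≠ -(n : ℂ)) :
    Xi χ z =
      ((Real.pi / m : ℝ) : ℂ) ^ (-(1 + 2 * (parity χ : ℂ) + 2 * Complex.I * z) / 4) *
        Complex.Gamma ((1 + 2 * (parity χ : ℂ) + 2 * Complex.I * z) / 4) *
        χ.LFunction ((1 + 2 * Complex.I * z) / 2) := by
  have hm1 : m ≠ 1 := by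
    rintro rfl
    exact hχ (DirichletCharacter.level_one χ)
  have hm0 : (0 : ℝ) < m := by exact_mod_cast Nat.pos_of_ne_zero (NeZero.ne m)
  set w : ℂ := (1 + 2 * (parity χ : ℂ) + 2 * Complex.I * z) / 4 with hw
  have hγ : χ.gammaFactor ((1 + 2 * Complex.I * z) / 2) =
      (Real.pi : ℂ) ^ (-w) * Complex.Gamma w := by
    rcases χ.even_or_odd with h | h
    · have ha : parity χ = 0 := if_pos h
      rw [h.gammaFactor_def, Complex.Gammaℝ_def]
      have : (1 + 2 * Complex.I * z) / 2 / 2 = w := by rw [hw, ha]; push_cast; ring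
      rw [neg_div, this]
    · have ha : parity χ = 1 := by
        refine if_neg ?_
        rw [show χ (-1) = -1 from h]
        norm_num
      rw [h.gammaFactor_def, Complex.Gammaℝ_def]
      have : ((1 + 2 * Complex.I * z) / 2 + 1) / 2 = w := by rw [hw, ha]; push_cast; ring
      rw [neg_div, this]
  have hπ : (Real.pi : ℂ) ≠ 0 := by exact_mod_cast Real.pi_ne_zero
  have hγ0 : (Real.pi : ℂ) ^ (-w) * Complex.Gamma w ≠ 0 :=
    mul_ne_zero (by simp [Complex.cpow_eq_zero_iff, hπ]) (Complex.Gamma_ne_zero hz)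
  have hL := DirichletCharacter.LFunction_eq_completed_div_gammaFactor χ
    ((1 + 2 * Complex.I * z) / 2) (Or.inr hm1)
  rw [hγ, eq_div_iff hγ0] at hL
  have hpow : ((Real.pi / m : ℝ) : ℂ) ^ (-w) = (Real.pi : ℂ) ^ (-w) * (m : ℂ) ^ w := by
    rw [div_eq_mul_inv, Complex.ofReal_mul,
      Complex.mul_cpow_ofReal_nonneg Real.pi_pos.le (inv_nonneg.mpr hm0.le)]
    congr 1
    rw [Complex.ofReal_inv, Complex.inv_cpow _ _ (by
      rw [Complex.arg_ofReal_of_nonneg hm0.le]; exact Real.pi_pos.ne), Complex.cpow_neg, inv_inv]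
    simp
  rw [neg_div, ← hw, hpow, Xi, ← hw, ← hL]
  ring

/-- The generalized Riemann hypothesis for `L(s, χ)`: every zero in the critical strip lies on the
critical line. -/
def GRH {m : ℕ} [NeZero m] (χ : DirichletCharacter ℂ m) : Prop :=
  ∀ s : ℂ, χ.LFunction s = 0 → 0 < s.re → s.re < 1 → s.re = 1 / 2

/-- The quotient `Ξ'(ρ √z, χ) / (√z Ξ(ρ √z, χ))`, as written. As `Ξ(·, χ)` is even, the branch of
the square root does not matter; the value at `z = 0` is the meaningless `0 / 0`. -/
noncomputable def rawQuotient {m : ℕ} [NeZero m] (χ : DirichletCharacter ℂ m) (ρ : ℝ) (z : ℂ) : ℂ :=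
  deriv (Xi χ) (ρ * z ^ (1 / 2 : ℂ)) / (z ^ (1 / 2 : ℂ) * Xi χ (ρ * z ^ (1 / 2 : ℂ)))

/-- The same quotient with its removable singularity at `z = 0` removed. -/
noncomputable def quotient {m : ℕ} [NeZero m] (χ : DirichletCharacter ℂ m) (ρ : ℝ) : ℂ → ℂ :=
  Function.update (rawQuotient χ ρ) 0 (Filter.limUnder (𝓝[≠] 0) (rawQuotient χ ρ))

end CharacterXi

namespace CharacterXi

/-! ### The Hausdorff moment problem -/

/-! The hypothesis φ ≥ 0 makes a positive multiple of Ξ the Mellin transform of a nonnegative theta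
function (`exists_hasMellin_Xi`). Hence Ξ(0) ≠ 0; the functional equation at s = 1/2 then forces the
root number to be 1, so Ξ is even. Moreover |Ξ| on a horizontal strip is controlled by its values on
the imaginary axis. So Ξ(ρz) = F(z²) with F entire, F(0) ≠ 0, and log|F| = o(R) on discs of radius
2R, for a sequence of R tending to infinity (`exists_growth_of_comp_sq`). The quotient in the
theorem is (2/ρ) F'/F (`quotient_eq`), and the zeros of Ξ are real of modulus at least ρ exactly
when the zeros of F lie in [1, ∞).

Let l send X^n to the n-th Taylor coefficient of -F'/F at 0. The sign conditions say that l(X^k (1 -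
X)^j) ≥ 0 (`iteratedDeriv_sub_one_pow_mul`), which is Hausdorff's condition for a moment sequence on
[0, 1].

If the zeros w of F lie in [1, ∞), the growth bound makes l(p) a limit of finite sums of w⁻¹ p(w⁻¹).
These are nonnegative for p = X^k (1 - X)^j because 0 < w⁻¹ ≤ 1 (`iteratedDeriv_nonpos_of_zeros`).

Conversely, Hausdorff's argument extends l to a continuous functional L on C[0, 1], and -F'/F = L((1
- zX)⁻¹) near 0. The right side is holomorphic off [1, ∞), and a relation F' = GF with G holomorphic
leaves F no zeros there (`exists_one_le_of_iteratedDeriv_nonpos`). A zero z of Ξ therefore has z² >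
0, so it is real. -/

open Polynomial unitInterval Filter in
-- These are the factorial moments of the binomial distribution. They write X^k exactly in the
-- Bernstein basis, with coefficients close to (ν/n)^k.
theorem sum_descFactorial_mul_bernsteinPolynomial {R : Type*} [CommRing R] (n k : ℕ) :
    ∑ ν ∈ Finset.range (n + 1), (ν.descFactorial k : R[X]) * bernsteinPolynomial R n ν =
      (n.descFactorial k : R[X]) * X ^ k := by
  rcases lt_or_ge n k with h | h
  · rw [Nat.descFactorial_eq_zero_iff_lt.2 h]
    refine (Finset.sum_eq_zero fun ν hν ↦ ?_).trans (by simp)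
    rw [Nat.descFactorial_eq_zero_iff_lt.2 (by have := Finset.mem_range.1 hν; omega)]
    simp
  obtain ⟨d, rfl⟩ := Nat.exists_eq_add_of_le h
  rw [add_assoc, Finset.sum_range_add, Finset.sum_eq_zero, zero_add]
  · have : ∀ i ∈ Finset.range (d + 1), ((k + i).descFactorial k : R[X]) *
        bernsteinPolynomial R (k + d) (k + i) =
        ((k + d).descFactorial k : R[X]) * X ^ k * bernsteinPolynomial R d i := by
      intro i hi
      have hi' : i ≤ d := by have := Finset.mem_range.1 hi; omega
      have hc : (k + i).descFactorial k * (k + d).choose (k + i) =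
          (k + d).descFactorial k * d.choose i := by
        have := Nat.choose_mul (n := k + d) (k := k + i) (s := k) (by omega)
        rw [Nat.descFactorial_eq_factorial_mul_choose, Nat.descFactorial_eq_factorial_mul_choose,
          mul_assoc, mul_assoc, mul_comm ((k + i).choose k), this]
        congr 3 <;> omega
      have hc' := congrArg (Nat.cast : ℕ → R[X]) hc
      push_cast at hc'
      rw [bernsteinPolynomial, bernsteinPolynomial, show k + d - (k + i) = d - i by omega, pow_add]
      linear_combination X ^ k * X ^ i * (1 - X) ^ (d - i) * hc'
    rw [Finset.sum_congr rfl this, ← Finset.mul_sum, bernsteinPolynomial.sum, mul_one]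
  · intro ν hν
    rw [Nat.descFactorial_eq_zero_iff_lt.2 (Finset.mem_range.1 hν)]
    simp

theorem exists_abs_pow_sub_descFactorial_div_le (k : ℕ) : ∀ ε : ℝ, 0 < ε → ∃ N : ℕ, ∀ n ≥ N,
    ∀ ν ≤ n, |((ν : ℝ) / n) ^ k - (ν.descFactorial k : ℝ) / n.descFactorial k| ≤ ε := by
  induction k with
  | zero => intro ε hε; exact ⟨0, fun n _ ν _ ↦ by simpa using hε.le⟩
  | succ k ih =>
    intro ε hε
    obtain ⟨N, hN⟩ := ih (ε / 2) (half_pos hε)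
    obtain ⟨M, hM⟩ := exists_nat_gt ((k : ℝ) / (ε / 2))
    refine ⟨max N (M + k + 1), fun n hn ν hν ↦ ?_⟩
    have hn1 : N ≤ n := le_trans (le_max_left _ _) hn
    have hn2 : M + k + 1 ≤ n := le_trans (le_max_right _ _) hn
    have hkn : (k : ℝ) < n := by exact_mod_cast (by omega : k < n)
    have hn0 : (0 : ℝ) < n := lt_of_le_of_lt k.cast_nonneg hkn
    have hνn : (ν : ℝ) ≤ n := by exact_mod_cast hν
    set b : ℝ := (ν.descFactorial k : ℝ) / n.descFactorial k with hb
    have hD : (0 : ℝ) < n.descFactorial k := by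
      exact_mod_cast Nat.descFactorial_pos.2 (by omega)
    have hb0 : 0 ≤ b := by positivity
    have hb1 : b ≤ 1 := by
      rw [hb, div_le_one hD]
      exact_mod_cast Nat.descFactorial_le k hν
    have hab := hN n hn1 ν hν
    have hx0 : 0 ≤ (ν : ℝ) / n := by positivity
    have hx1 : (ν : ℝ) / n ≤ 1 := (div_le_one hn0).2 hνn
    have hsmall : (k : ℝ) / (n - k) ≤ ε / 2 := by
      have : (M : ℝ) ≤ n - k := by
        have : ((M + k + 1 : ℕ) : ℝ) ≤ n := by exact_mod_cast hn2
        push_cast at this; linarith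
      rw [div_le_iff₀ (by linarith)]
      rw [div_lt_iff₀ (half_pos hε)] at hM
      nlinarith
    have key : |b * ((ν : ℝ) / n) - (ν.descFactorial (k + 1) : ℝ) / n.descFactorial (k + 1)| ≤
        ε / 2 := by
      rcases lt_or_ge ν k with h | h
      · have h0 : b = 0 := by rw [hb, Nat.descFactorial_eq_zero_iff_lt.2 h]; simp
        rw [h0, Nat.descFactorial_eq_zero_iff_lt.2 (by omega : ν < k + 1)]
        simpa using (half_pos hε).le
      · have hkν : (k : ℝ) ≤ ν := by exact_mod_cast h
        have hsplit : (ν.descFactorial (k + 1) : ℝ) / n.descFactorial (k + 1) =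
            b * ((ν - k) / (n - k)) := by
          rw [Nat.descFactorial_succ, Nat.descFactorial_succ, Nat.cast_mul, Nat.cast_mul,
            Nat.cast_sub h, Nat.cast_sub (by omega), mul_div_mul_comm, mul_comm]
        rw [hsplit, ← mul_sub, abs_mul, abs_of_nonneg hb0]
        have hdiff : (ν : ℝ) / n - (ν - k) / (n - k) = k / (n - k) * ((n - ν) / n) := by
          have : (n : ℝ) - k ≠ 0 := by linarith
          field_simp
          ring
        have hq0 : 0 ≤ (k : ℝ) / (n - k) := div_nonneg k.cast_nonneg (by linarith)
        have hq1 : ((n : ℝ) - ν) / n ≤ 1 := (div_le_one hn0).2 (by linarith [ν.cast_nonneg (α := ℝ)])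
        have hq2 : 0 ≤ ((n : ℝ) - ν) / n := div_nonneg (by linarith) hn0.le
        rw [hdiff, abs_of_nonneg (mul_nonneg hq0 hq2)]
        calc b * (k / (n - k) * ((n - ν) / n)) ≤ 1 * (k / (n - k) * 1) := by gcongr
          _ ≤ ε / 2 := by linarith
    calc |((ν : ℝ) / n) ^ (k + 1) - (ν.descFactorial (k + 1) : ℝ) / n.descFactorial (k + 1)|
        = |(((ν : ℝ) / n) ^ k - b) * (ν / n) +
          (b * ((ν : ℝ) / n) - (ν.descFactorial (k + 1) : ℝ) / n.descFactorial (k + 1))| := by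
          congr 1; ring
      _ ≤ |(((ν : ℝ) / n) ^ k - b) * (ν / n)| + ε / 2 := (abs_add_le _ _).trans (by gcongr)
      _ ≤ ε / 2 * 1 + ε / 2 := by
          rw [abs_mul, abs_of_nonneg hx0]; gcongr
      _ = ε := by ring

/-- The inclusion of the unit interval into `ℂ`. -/
noncomputable def intervalCoe : C(unitInterval, ℂ) :=
  ⟨fun x ↦ ((x : ℝ) : ℂ), by fun_prop⟩

@[simp] theorem intervalCoe_apply (x : unitInterval) : intervalCoe x = ((x : ℝ) : ℂ) := rfl

open Polynomial Filter in
/-- A linear functional on polynomials that is nonnegative on all `X ^ k * (1 - X) ^ j` extends to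
a continuous functional on the continuous functions on `[0, 1]`. -/
theorem exists_continuousLinearMap_of_nonneg (l : ℂ[X] →ₗ[ℂ] ℂ)
    (hl : ∀ j k : ℕ, 0 ≤ l (X ^ k * (1 - X) ^ j)) :
    ∃ L : C(unitInterval, ℂ) →L[ℂ] ℂ, ∀ n : ℕ, L (intervalCoe ^ n) = l (X ^ n) := by
  have hbern : ∀ n ν : ℕ, 0 ≤ l (bernsteinPolynomial ℂ n ν) := by
    intro n ν
    have : bernsteinPolynomial ℂ n ν = (n.choose ν : ℂ) • (X ^ ν * (1 - X) ^ (n - ν)) := by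
      rw [bernsteinPolynomial, mul_assoc, smul_eq_C_mul]; simp
    rw [this, map_smul, smul_eq_mul]
    exact mul_nonneg (by exact_mod_cast Nat.zero_le _) (hl _ _)
  have hsum : ∀ n : ℕ, ∑ ν ∈ Finset.range (n + 1), ‖l (bernsteinPolynomial ℂ n ν)‖ = ‖l 1‖ := by
    intro n
    have h1 : 0 ≤ l 1 := by simpa using hl 0 0
    have : ((∑ ν ∈ Finset.range (n + 1), ‖l (bernsteinPolynomial ℂ n ν)‖ : ℝ) : ℂ) =
        (‖l 1‖ : ℂ) := by
      rw [← Complex.eq_coe_norm_of_nonneg h1, Complex.ofReal_sum, ← bernsteinPolynomial.sum ℂ n,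
        map_sum]
      exact Finset.sum_congr rfl fun ν _ ↦ (Complex.eq_coe_norm_of_nonneg (hbern n ν)).symm
    exact_mod_cast this
  -- The discrete measures with mass l(B_{n,ν}) at ν/n approximate l. The masses are nonnegative and
  -- the Bernstein polynomials sum to 1, so the norms stay below ‖l 1‖; by Banach–Alaoglu the
  -- sequence has a weak-* cluster point.
  let pt : ℕ → ℕ → unitInterval := fun n ν ↦ Set.projIcc 0 1 zero_le_one ((ν : ℝ) / n)
  let A : ℕ → (C(unitInterval, ℂ) →L[ℂ] ℂ) := fun n ↦
    ∑ ν ∈ Finset.range (n + 1), l (bernsteinPolynomial ℂ n ν) • ContinuousMap.evalCLM ℂ (pt n ν)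
  have hA : ∀ n f, A n f = ∑ ν ∈ Finset.range (n + 1),
      l (bernsteinPolynomial ℂ n ν) * f (pt n ν) := by
    intro n f
    simp [A, ContinuousMap.evalCLM]
  have hAn : ∀ n, ‖A n‖ ≤ ‖l 1‖ := by
    intro n
    refine ContinuousLinearMap.opNorm_le_bound _ (norm_nonneg _) fun f ↦ ?_
    rw [hA, ← hsum n, Finset.sum_mul]
    refine (norm_sum_le _ _).trans (Finset.sum_le_sum fun ν _ ↦ ?_)
    rw [norm_mul]
    gcongr
    exact f.norm_coe_le_norm _
  have hlim : ∀ k, Tendsto (fun n ↦ A n (intervalCoe ^ k)) atTop (𝓝 (l (X ^ k))) := by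
    intro k
    rw [Metric.tendsto_atTop]
    intro ε hε
    obtain ⟨N, hN⟩ := exists_abs_pow_sub_descFactorial_div_le k (ε / (2 * (‖l 1‖ + 1)))
      (by positivity)
    refine ⟨max N (k + 1), fun n hn ↦ ?_⟩
    have hn1 : N ≤ n := le_trans (le_max_left _ _) hn
    have hn2 : k + 1 ≤ n := le_trans (le_max_right _ _) hn
    have hD : (n.descFactorial k : ℂ) ≠ 0 := by
      exact_mod_cast (Nat.descFactorial_pos.2 (by omega)).ne'
    have hlX : l (X ^ k) = ∑ ν ∈ Finset.range (n + 1), l (bernsteinPolynomial ℂ n ν) *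
        (((ν.descFactorial k : ℝ) / n.descFactorial k : ℝ) : ℂ) := by
      have h := congrArg l (sum_descFactorial_mul_bernsteinPolynomial (R := ℂ) n k)
      have hnat : ∀ (c : ℕ) (p : ℂ[X]), l ((c : ℂ[X]) * p) = (c : ℂ) * l p := by
        intro c p
        rw [← smul_eq_mul (c : ℂ), ← map_smul, smul_eq_C_mul]; simp
      rw [hnat, map_sum] at h
      rw [← mul_right_inj' hD, ← h, Finset.mul_sum]
      refine Finset.sum_congr rfl fun ν _ ↦ ?_
      rw [hnat]
      push_cast
      field_simp
    rw [dist_eq_norm, hA, hlX, ← Finset.sum_sub_distrib]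
    refine lt_of_le_of_lt (norm_sum_le _ _) ?_
    have hterm : ∀ ν ∈ Finset.range (n + 1), ‖l (bernsteinPolynomial ℂ n ν) *
        (intervalCoe ^ k) (pt n ν) - l (bernsteinPolynomial ℂ n ν) *
        (((ν.descFactorial k : ℝ) / n.descFactorial k : ℝ) : ℂ)‖ ≤
        ‖l (bernsteinPolynomial ℂ n ν)‖ * (ε / (2 * (‖l 1‖ + 1))) := by
      intro ν hν
      have hν' : ν ≤ n := by have := Finset.mem_range.1 hν; omega
      have hn0 : (0 : ℝ) < n := by exact_mod_cast (by omega : 0 < n)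
      have hpt : ((pt n ν : unitInterval) : ℝ) = (ν : ℝ) / n := by
        have : (ν : ℝ) / n ∈ Set.Icc (0 : ℝ) 1 :=
          ⟨by positivity, (div_le_one hn0).2 (by exact_mod_cast hν')⟩
        simp only [pt]
        rw [Set.projIcc_of_mem _ this]
      rw [← mul_sub, norm_mul]
      gcongr
      rw [ContinuousMap.pow_apply, intervalCoe_apply, hpt, ← Complex.ofReal_pow,
        ← Complex.ofReal_sub, Complex.norm_real, Real.norm_eq_abs]
      exact hN n hn1 ν hν'
    refine lt_of_le_of_lt (Finset.sum_le_sum hterm) ?_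
    rw [← Finset.sum_mul, hsum, ← mul_div_assoc, div_lt_iff₀ (by positivity)]
    nlinarith [norm_nonneg (l 1)]
  obtain ⟨L, -, hL⟩ := (WeakDual.isCompact_closedBall (𝕜 := ℂ) (E := C(unitInterval, ℂ)) 0
    ‖l 1‖).exists_mapClusterPt (f := atTop)
    (u := fun n : ℕ ↦ StrongDual.toWeakDual (A n)) (by
      refine le_principal_iff.2 (mem_map.2 (Eventually.of_forall fun n ↦ ?_))
      simpa using hAn n)
  refine ⟨WeakDual.toStrongDual L, fun k ↦ ?_⟩
  have hc := hL.continuousAt_comp (f := fun M : WeakDual ℂ C(unitInterval, ℂ) ↦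
    M (intervalCoe ^ k)) (WeakDual.eval_continuous _).continuousAt
  have h2 : Tendsto ((fun M : WeakDual ℂ C(unitInterval, ℂ) ↦ M (intervalCoe ^ k)) ∘
      fun n : ℕ ↦ StrongDual.toWeakDual (A n)) atTop (𝓝 (l (X ^ k))) := hlim k
  -- Along the whole sequence the values at X^k converge to l(X^k), so the cluster point must take
  -- this value.
  exact eq_of_nhds_neBot (ClusterPt.mono hc h2)

/-! ### Taylor coefficients as a functional on polynomials -/

open Polynomial in
/-- The functional sending `X ^ n` to the `n`-th Taylor coefficient of `g` at `0`. -/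
noncomputable def taylorFunctional (g : ℂ → ℂ) : ℂ[X] →ₗ[ℂ] ℂ :=
  Polynomial.lsum fun n ↦ ((n.factorial : ℂ)⁻¹ * iteratedDeriv n g 0) • LinearMap.id

open Polynomial in
theorem taylorFunctional_X_pow (g : ℂ → ℂ) (n : ℕ) :
    taylorFunctional g (X ^ n) = (n.factorial : ℂ)⁻¹ * iteratedDeriv n g 0 := by
  rw [taylorFunctional, Polynomial.lsum_apply, ← Polynomial.monomial_one_right_eq_X_pow,
    Polynomial.sum_monomial_index] <;> simp

theorem iteratedDeriv_succ_sub_one_mul {h : ℂ → ℂ} (hh : AnalyticAt ℂ h 0) (n : ℕ) :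
    iteratedDeriv (n + 1) (fun z ↦ (z - 1) * h z) 0 =
      (n + 1) * iteratedDeriv n h 0 - iteratedDeriv (n + 1) h 0 := by
  have h1 : iteratedDeriv 1 (fun z : ℂ ↦ z - 1) = fun _ ↦ 1 := by
    ext z; simp
  have h2 : ∀ i, iteratedDeriv (i + 2) (fun z : ℂ ↦ z - 1) 0 = 0 := by
    intro i
    have hd : deriv (fun z : ℂ ↦ z - 1) = fun _ ↦ 1 := by ext z; simp
    rw [iteratedDeriv_succ', hd, iteratedDeriv_const]
    simp
  have hm := iteratedDeriv_mul (𝕜 := ℂ) (n := n + 1) (x := 0) (f := fun z : ℂ ↦ z - 1) (g := h)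
    (by fun_prop) hh.contDiffAt
  change iteratedDeriv (n + 1) ((fun z : ℂ ↦ z - 1) * h) 0 = _
  rw [hm, Finset.sum_range_succ', Finset.sum_range_succ', Finset.sum_eq_zero]
  · simp [h1]; ring
  · intro i _
    rw [h2]; simp

open Polynomial in
-- Multiplying a power series by z - 1 replaces its coefficients by the differences c_n - c_{n+1},
-- which on the polynomial side is multiplication by 1 - X. The derivatives in the theorem thus
-- become Hausdorff's iterated differences.
theorem iteratedDeriv_sub_one_pow_mul {g : ℂ → ℂ} (hg : AnalyticAt ℂ g 0) (j : ℕ) : ∀ k : ℕ,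
    iteratedDeriv (j + k) (fun z ↦ (z - 1) ^ j * g z) 0 =
      ((j + k).factorial : ℂ) * taylorFunctional g (X ^ k * (1 - X) ^ j) := by
  induction j with
  | zero =>
    intro k
    have : (k.factorial : ℂ) ≠ 0 := by exact_mod_cast k.factorial_ne_zero
    simp [taylorFunctional_X_pow, this]
  | succ j ih =>
    intro k
    have ha : AnalyticAt ℂ (fun z ↦ (z - 1) ^ j * g z) 0 := by fun_prop
    have hs := iteratedDeriv_succ_sub_one_mul ha (j + k)
    have hfun : (fun z ↦ (z - 1) ^ (j + 1) * g z) = fun z ↦ (z - 1) * ((z - 1) ^ j * g z) := by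
      ext z; ring
    have hpoly : (X ^ k * (1 - X) ^ (j + 1) : ℂ[X]) =
        X ^ k * (1 - X) ^ j - X ^ (k + 1) * (1 - X) ^ j := by ring
    rw [hfun, show j + 1 + k = j + k + 1 by ring, hs, ih k, show j + k + 1 = j + (k + 1) by ring,
      ih (k + 1), hpoly, map_sub, show j + (k + 1) = (j + k) + 1 by ring, Nat.factorial_succ]
    push_cast
    ring

/-! ### From the sign conditions to the location of the zeros -/

/-- `z ↦ 1 - z X` in the algebra of continuous functions on `[0, 1]`. -/
noncomputable def resolventPencil (z : ℂ) : C(unitInterval, ℂ) := 1 - z • intervalCoe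

theorem continuous_resolventPencil : Continuous resolventPencil := by
  unfold resolventPencil; fun_prop

theorem isUnit_resolventPencil_iff (z : ℂ) :
    IsUnit (resolventPencil z) ↔ ∀ x : unitInterval, 1 - z * ((x : ℝ) : ℂ) ≠ 0 := by
  rw [ContinuousMap.isUnit_iff_forall_ne_zero]
  rfl

theorem isUnit_resolventPencil_zero : IsUnit (resolventPencil 0) := by
  rw [isUnit_resolventPencil_iff]; simp

/-- The set is the complement of [1, ∞), which is star-shaped about 0: scaling z by a in [0, 1]
amounts to replacing x by ax in [0, 1]. -/
theorem isPreconnected_isUnit_resolventPencil :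
    IsPreconnected {z : ℂ | IsUnit (resolventPencil z)} := by
  have hstar : StarConvex ℝ 0 {z : ℂ | IsUnit (resolventPencil z)} := by
    rw [starConvex_zero_iff]
    intro z hz a ha0 ha1
    rw [Set.mem_ofPred_eq, isUnit_resolventPencil_iff] at hz ⊢
    intro x
    have := hz (⟨a, ha0, ha1⟩ * x)
    simpa [mul_comm, mul_assoc, mul_left_comm] using this
  exact (hstar.isPathConnected isUnit_resolventPencil_zero).isConnected.isPreconnected

theorem analyticAt_logDeriv {F : ℂ → ℂ} (hF : Differentiable ℂ F) {z : ℂ} (hz : F z ≠ 0) :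
    AnalyticAt ℂ (logDeriv F) z :=
  (hF.analyticAt z).deriv.div (hF.analyticAt z) hz

/-- The identity F' = GF spreads from 0 to all of U. At a zero of F the order of GF is at least that
of F, while the order of F' is one less; the order is finite since F is not identically zero. -/
theorem ne_zero_of_deriv_eq_mul {F G : ℂ → ℂ} {U : Set ℂ} (hF : Differentiable ℂ F) (hF0 : F 0 ≠ 0)
    (hU : IsOpen U) (hUc : IsPreconnected U) (h0 : 0 ∈ U) (hG : DifferentiableOn ℂ G U)
    (hGF : ∀ᶠ z in 𝓝 0, deriv F z = G z * F z) {w : ℂ} (hw : w ∈ U) : F w ≠ 0 := by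
  intro hFw
  have hGa : AnalyticOnNhd ℂ G U := hG.analyticOnNhd hU
  have hFa : AnalyticOnNhd ℂ F Set.univ := fun z _ ↦ hF.analyticAt z
  have heq : Set.EqOn (deriv F) (G * F) U :=
    AnalyticOnNhd.eqOn_of_preconnected_of_eventuallyEq (fun z _ ↦ (hF.analyticAt z).deriv)
      (hGa.mul fun z _ ↦ hF.analyticAt z) hUc h0 hGF
  have htop : analyticOrderAt F w ≠ ⊤ := by
    intro h
    rw [analyticOrderAt_eq_top] at h
    have := hFa.eqOn_zero_of_preconnected_of_eventuallyEq_zero isPreconnected_univ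
      (Set.mem_univ w) h
    exact hF0 (this (Set.mem_univ 0))
  have h1 := (hF.analyticAt w).analyticOrderAt_deriv_add_one
  simp only [hFw, sub_zero] at h1
  have h2 : analyticOrderAt (deriv F) w = analyticOrderAt G w + analyticOrderAt F w := by
    rw [analyticOrderAt_congr (heq.eventuallyEq_of_mem (hU.mem_nhds hw))]
    exact analyticOrderAt_mul (hGa w hw) (hF.analyticAt w)
  have h3 : analyticOrderAt F w + 1 ≤ analyticOrderAt F w := by
    calc analyticOrderAt F w + 1 ≤ analyticOrderAt (deriv F) w + 1 := by
          rw [h2]; gcongr; exact le_add_self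
      _ = _ := h1
  rw [ENat.add_one_le_iff htop] at h3
  exact lt_irrefl _ h3

open Polynomial in
/-- If all the sign conditions on the logarithmic derivative at `0` hold, then the zeros of an
entire function lie in `[1, ∞)`. -/
theorem exists_one_le_of_iteratedDeriv_nonpos {F : ℂ → ℂ} (hF : Differentiable ℂ F)
    (hF0 : F 0 ≠ 0)
    (h : ∀ j k : ℕ, iteratedDeriv (j + k) (fun z ↦ (z - 1) ^ j * logDeriv F z) 0 ≤ 0)
    {w : ℂ} (hw : F w = 0) : ∃ x : ℝ, 1 ≤ x ∧ w = x := by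
  have hg : ∀ z, F z ≠ 0 → AnalyticAt ℂ (logDeriv F) z := fun z hz ↦
    analyticAt_logDeriv hF hz
  have hl : ∀ j k : ℕ, 0 ≤ (-taylorFunctional (logDeriv F)) (X ^ k * (1 - X) ^ j) := by
    intro j k
    have h1 := h j k
    rw [iteratedDeriv_sub_one_pow_mul (hg 0 hF0)] at h1
    have h2 : (0 : ℂ) < ((j + k).factorial : ℂ) := by exact_mod_cast (j + k).factorial_pos
    rw [LinearMap.neg_apply]
    refine neg_nonneg.2 ?_
    by_contra hcon
    have h3 := mul_le_mul_of_nonneg_left h1 (inv_nonneg.2 h2.le)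
    rw [← mul_assoc, inv_mul_cancel₀ h2.ne', one_mul, mul_zero] at h3
    exact hcon h3
  obtain ⟨L, hL⟩ := exists_continuousLinearMap_of_nonneg _ hl
  set U : Set ℂ := {z : ℂ | IsUnit (resolventPencil z)}
  have hU : IsOpen U := Units.isOpen.preimage continuous_resolventPencil
  have hG : DifferentiableOn ℂ (fun z ↦ -L (Ring.inverse (resolventPencil z))) U := by
    intro z hz
    refine DifferentiableAt.differentiableWithinAt ?_
    have hd : DifferentiableAt ℂ resolventPencil z := by unfold resolventPencil; fun_prop
    exact (L.differentiableAt.comp z ((differentiableAt_inverse hz).comp z hd)).neg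
  -- For |z| < 1 the resolvent is a Neumann series; applying L term by term gives the Taylor series
  -- of -F'/F, the sign coming from the definition of l.
  have hnear : ∀ᶠ z in 𝓝 0, deriv F z = -L (Ring.inverse (resolventPencil z)) * F z := by
    obtain ⟨r, hr, hball⟩ := Metric.eventually_nhds_iff_ball.1
      (hF.continuous.continuousAt.eventually_ne hF0)
    filter_upwards [Metric.ball_mem_nhds 0 hr, Metric.ball_mem_nhds 0 one_pos] with z hz hz1
    have hdiff : DifferentiableOn ℂ (logDeriv F) (Metric.ball 0 r) := fun y hy ↦
      (hg y (hball y hy)).differentiableAt.differentiableWithinAt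
    have hT := Complex.hasSum_taylorSeries_on_ball hdiff hz
    have hnorm : ‖z • intervalCoe‖ < 1 := by
      rw [norm_smul]
      have h1 : ‖intervalCoe‖ ≤ 1 := by
        rw [ContinuousMap.norm_le _ zero_le_one]
        intro x
        rw [intervalCoe_apply, Complex.norm_real, Real.norm_eq_abs, abs_of_nonneg x.2.1]
        exact x.2.2
      have h2 : ‖z‖ < 1 := by simpa using hz1
      nlinarith [norm_nonneg z, norm_nonneg intervalCoe]
    have hgeom : HasSum (fun n ↦ (z • intervalCoe) ^ n) (Ring.inverse (resolventPencil z)) := by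
      have hs := (summable_geometric_of_norm_lt_one hnorm).hasSum
      have : Ring.inverse (resolventPencil z) = ∑' n, (z • intervalCoe) ^ n := by
        exact Ring.inverse_unit ⟨_, _,
          (summable_geometric_of_norm_lt_one hnorm).one_sub_mul_tsum_pow,
          (summable_geometric_of_norm_lt_one hnorm).tsum_pow_mul_one_sub⟩
      rwa [this]
    have hLs := (L.hasSum hgeom).neg
    have hterm : (fun n ↦ -(L ((z • intervalCoe) ^ n))) =
        fun n : ℕ ↦ (n.factorial : ℂ)⁻¹ • (z - 0) ^ n • iteratedDeriv n (logDeriv F) 0 := by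
      ext n
      rw [_root_.smul_pow, map_smul, hL, LinearMap.neg_apply, taylorFunctional_X_pow]
      simp only [smul_eq_mul, sub_zero]
      ring
    rw [show (fun b ↦ -((fun n ↦ (z • intervalCoe) ^ n) |> fun f ↦ L (f b))) = _ from hterm] at hLs
    rw [hLs.unique hT, logDeriv_apply, div_mul_cancel₀ _ (hball z hz)]
  have hwU : w ∉ U := fun hwU ↦ ne_zero_of_deriv_eq_mul hF hF0 hU
    isPreconnected_isUnit_resolventPencil isUnit_resolventPencil_zero hG hnear hwU hw
  simp only [U, Set.mem_ofPred_eq, isUnit_resolventPencil_iff, not_forall, not_not] at hwU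
  obtain ⟨x, hx⟩ := hwU
  have hx1 : w * ((x : ℝ) : ℂ) = 1 := (sub_eq_zero.1 hx).symm
  have hx0 : (x : ℝ) ≠ 0 := by
    intro h0; rw [h0] at hx1; simp at hx1
  refine ⟨(x : ℝ)⁻¹, (one_le_inv₀ (lt_of_le_of_ne x.2.1 hx0.symm)).2 x.2.2, ?_⟩
  rw [Complex.ofReal_inv]
  exact eq_inv_of_mul_eq_one_left hx1

/-! ### Even entire functions -/

/-- An even entire function is an entire function of the square. -/
theorem exists_differentiable_comp_sq {H : ℂ → ℂ} (hH : Differentiable ℂ H)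
    (heven : ∀ z, H (-z) = H z) : ∃ F : ℂ → ℂ, Differentiable ℂ F ∧ ∀ z, F (z ^ 2) = H z := by
  let s : ℂ → ℂ := fun w ↦ w ^ (1 / 2 : ℂ)
  have hs : ∀ w, s w ^ 2 = w := by
    intro w
    simp [s]
  have hF : ∀ z, H (s (z ^ 2)) = H z := by
    intro z
    rcases sq_eq_sq_iff_eq_or_eq_neg.1 (hs (z ^ 2)) with h | h
    · rw [h]
    · rw [h, heven]
  -- The principal root jumps across its cut, but H is even, so near w ≠ 0 it may be replaced by a
  -- local holomorphic inverse of squaring. At 0 continuity suffices, by removability.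
  have hne : ∀ w : ℂ, w ≠ 0 → DifferentiableAt ℂ (fun w ↦ H (s w)) w := by
    intro w hw
    have hz : s w ≠ 0 := by
      intro h; apply hw; rw [← hs w, h]; simp
    have hd : HasStrictDerivAt (fun z : ℂ ↦ z ^ 2) (2 * s w) (s w) := by
      simpa using hasStrictDerivAt_pow 2 (s w)
    have hd0 : 2 * s w ≠ 0 := mul_ne_zero two_ne_zero hz
    have hr := hd.eventually_right_inverse hd0
    have hl := (hd.to_localInverse hd0).hasDerivAt.differentiableAt
    simp only [hs] at hr hl
    refine ((hH _).comp w hl).congr_of_eventuallyEq ?_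
    filter_upwards [hr] with y hy
    calc H (s y) = H (s (hd.localInverse _ _ _ hd0 y ^ 2)) := by rw [hy]
      _ = _ := hF _
  refine ⟨fun w ↦ H (s w), fun w ↦ ?_, hF⟩
  rcases eq_or_ne w 0 with rfl | hw
  · refine (Complex.analyticAt_of_differentiable_on_punctured_nhds_of_continuousAt ?_
      ?_).differentiableAt
    · filter_upwards [self_mem_nhdsWithin] with w hw using hne w hw
    · have : ContinuousAt s 0 := Complex.continuousAt_cpow_const_of_re_pos (by simp) (by norm_num)
      exact hH.continuous.continuousAt.comp this
  · exact hne w hw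

/-! ### From the location of the zeros to the sign conditions -/

/-- The polynomial with constant coefficient `1` and the given zeros. -/
noncomputable def zeroProd (s : Multiset ℂ) (z : ℂ) : ℂ := (s.map fun w ↦ 1 - z / w).prod

@[simp] theorem zeroProd_zero (z : ℂ) : zeroProd 0 z = 1 := by simp [zeroProd]

@[simp] theorem zeroProd_cons (w : ℂ) (s : Multiset ℂ) (z : ℂ) :
    zeroProd (w ::ₘ s) z = (1 - z / w) * zeroProd s z := by simp [zeroProd]

@[simp] theorem zeroProd_apply_zero (s : Multiset ℂ) : zeroProd s 0 = 1 := by simp [zeroProd]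

theorem differentiable_zeroProd (s : Multiset ℂ) : Differentiable ℂ (zeroProd s) := by
  induction s using Multiset.induction with
  | empty => simp [funext zeroProd_zero]
  | cons w s ih =>
    rw [funext (zeroProd_cons w s)]
    fun_prop

theorem pow_card_le_norm_zeroProd {s : Multiset ℂ} {R c : ℝ} (hc : 0 ≤ c) {z : ℂ}
    (hs : ∀ w ∈ s, w ≠ 0 ∧ ‖w‖ ≤ R) (hz : (c + 1) * R ≤ ‖z‖) :
    c ^ Multiset.card s ≤ ‖zeroProd s z‖ := by
  induction s using Multiset.induction with
  | empty => simp
  | cons w s ih =>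
    rw [zeroProd_cons, norm_mul, Multiset.card_cons, pow_succ, mul_comm]
    have hw := hs w (Multiset.mem_cons_self _ _)
    have hw0 : 0 < ‖w‖ := norm_pos_iff.2 hw.1
    have h1 : c ≤ ‖1 - z / w‖ := by
      have h2 : c + 1 ≤ ‖z / w‖ := by
        rw [norm_div, le_div_iff₀ hw0]
        exact (mul_le_mul_of_nonneg_left hw.2 (by positivity)).trans hz
      have h3 := norm_sub_norm_le (z / w) 1
      rw [norm_one, norm_sub_rev] at h3
      linarith
    exact mul_le_mul h1 (ih fun v hv ↦ hs v (Multiset.mem_cons_of_mem hv)) (by positivity)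
      (norm_nonneg _)

theorem exists_eq_one_sub_div_mul {h : ℂ → ℂ} (hh : Differentiable ℂ h) {w : ℂ} (hw : h w = 0)
    (hw0 : w ≠ 0) : ∃ q : ℂ → ℂ, Differentiable ℂ q ∧ ∀ z, h z = (1 - z / w) * q z := by
  refine ⟨fun z ↦ -w * dslope h w z, ?_, fun z ↦ ?_⟩
  · have : Differentiable ℂ (dslope h w) := by
      rw [← differentiableOn_univ] at hh ⊢
      exact (Complex.differentiableOn_dslope Filter.univ_mem).2 hh
    fun_prop
  · have h1 := sub_smul_dslope h w z
    rw [hw, sub_zero, smul_eq_mul] at h1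
    rw [← h1]
    field_simp
    ring

theorem norm_le_div_pow_of_eq_zeroProd_mul {F h : ℂ → ℂ} (hh : Differentiable ℂ h)
    {s : Multiset ℂ} (hFh : ∀ z, F z = zeroProd s z * h z) {R c C : ℝ} (hc : 0 < c) (hR : 0 < R)
    (hs : ∀ w ∈ s, w ≠ 0 ∧ ‖w‖ ≤ R) (hC : ∀ z, ‖z‖ ≤ (c + 1) * R → ‖F z‖ ≤ C)
    {z : ℂ} (hz : ‖z‖ ≤ (c + 1) * R) : ‖h z‖ ≤ C / c ^ Multiset.card s := by
  have hr : (0 : ℝ) < (c + 1) * R := by positivity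
  refine Complex.norm_le_of_forall_mem_frontier_norm_le (U := Metric.ball 0 ((c + 1) * R))
    Metric.isBounded_ball hh.diffContOnCl (fun y hy ↦ ?_) ?_
  · rw [frontier_ball _ hr.ne', mem_sphere_zero_iff_norm] at hy
    rw [le_div_iff₀ (by positivity)]
    calc ‖h y‖ * c ^ Multiset.card s ≤ ‖h y‖ * ‖zeroProd s y‖ := by
          gcongr; exact pow_card_le_norm_zeroProd hc.le hs hy.ge
      _ = ‖F y‖ := by rw [hFh, norm_mul, mul_comm]
      _ ≤ C := hC y hy.le
  · rw [closure_ball _ hr.ne', mem_closedBall_zero_iff]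
    exact hz

/-- An entire function that does not vanish at `0` is the product of a polynomial formed from its
zeros in a ball and an entire function without zeros in that ball. -/
theorem exists_eq_zeroProd_mul {F : ℂ → ℂ} (hF : Differentiable ℂ F) (hF0 : F 0 ≠ 0) {R : ℝ}
    (hR : 0 < R) : ∃ (s : Multiset ℂ) (h : ℂ → ℂ), Differentiable ℂ h ∧
      (∀ w ∈ s, F w = 0 ∧ ‖w‖ < R) ∧ (∀ z, F z = zeroProd s z * h z) ∧
      ∀ z ∈ Metric.ball (0 : ℂ) R, h z ≠ 0 := by
  by_contra! hcon
  have hall : ∀ n : ℕ, ∃ (s : Multiset ℂ) (h : ℂ → ℂ), Multiset.card s = n ∧ Differentiable ℂ h ∧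
      (∀ w ∈ s, F w = 0 ∧ ‖w‖ < R) ∧ (∀ z, F z = zeroProd s z * h z) := by
    intro n
    induction n with
    | zero => exact ⟨0, F, rfl, hF, by simp, by simp⟩
    | succ n ih =>
      obtain ⟨s, h, hn, hh, hs, hFh⟩ := ih
      obtain ⟨w, hw, hw0⟩ := hcon s h hh hs hFh
      have hFw : F w = 0 := by rw [hFh, hw0, mul_zero]
      have hw00 : w ≠ 0 := by rintro rfl; exact hF0 hFw
      obtain ⟨q, hq, hhq⟩ := exists_eq_one_sub_div_mul hh hw0 hw00
      refine ⟨w ::ₘ s, q, by simp [hn], hq, ?_, fun z ↦ ?_⟩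
      · intro v hv
        rcases Multiset.mem_cons.1 hv with rfl | hv
        · exact ⟨hFw, by simpa using hw⟩
        · exact hs v hv
      · rw [hFh, hhq, zeroProd_cons]; ring
  obtain ⟨C, hC⟩ := (isCompact_closedBall (0 : ℂ) ((2 + 1) * R)).exists_bound_of_continuousOn
    hF.continuous.continuousOn
  obtain ⟨n, hn⟩ := pow_unbounded_of_one_lt (C / ‖F 0‖) (one_lt_two (α := ℝ))
  obtain ⟨s, h, hcard, hh, hs, hFh⟩ := hall n
  -- If zeros could be split off forever, n of them would give |F(0)| = |h(0)| ≤ C/2^n: each factor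
  -- 1 - z/w has modulus at least 2 on |z| = 3R.
  have hs' : ∀ w ∈ s, w ≠ 0 ∧ ‖w‖ ≤ R := fun w hw ↦
    ⟨by rintro rfl; exact hF0 (hs 0 hw).1, (hs w hw).2.le⟩
  have hb := norm_le_div_pow_of_eq_zeroProd_mul hh hFh two_pos hR hs'
    (fun z hz ↦ hC z (by simpa using hz)) (z := 0) (by simpa using by positivity)
  have hF0' : F 0 = h 0 := by rw [hFh]; simp
  rw [← hF0', hcard, le_div_iff₀ (by positivity)] at hb
  rw [div_lt_iff₀ (norm_pos_iff.2 hF0)] at hn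
  linarith

/-- A function without zeros in a ball has a holomorphic logarithm there. -/
theorem exists_eq_mul_exp {h : ℂ → ℂ} {R : ℝ} (hR : 0 < R)
    (hh : DifferentiableOn ℂ h (Metric.ball 0 R)) (hne : ∀ z ∈ Metric.ball (0 : ℂ) R, h z ≠ 0) :
    ∃ q : ℂ → ℂ, q 0 = 0 ∧ (∀ z ∈ Metric.ball (0 : ℂ) R, HasDerivAt q (logDeriv h z) z) ∧
      ∀ z ∈ Metric.ball (0 : ℂ) R, h z = h 0 * Complex.exp (q z) := by
  have hld : DifferentiableOn ℂ (logDeriv h) (Metric.ball 0 R) :=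
    (hh.deriv Metric.isOpen_ball).div hh hne
  obtain ⟨q, hq0, hq⟩ := hld.isExactOn_ball.with_val_at 0 0
  refine ⟨q, hq0, hq, fun z hz ↦ ?_⟩
  have hd : ∀ y ∈ Metric.ball (0 : ℂ) R, HasDerivAt (fun y ↦ h y * Complex.exp (-q y)) 0 y := by
    intro y hy
    have h1 := (hh.differentiableAt (Metric.isOpen_ball.mem_nhds hy)).hasDerivAt
    refine (h1.mul (hq y hy).neg.cexp).congr_deriv ?_
    rw [logDeriv_apply]
    field_simp [hne y hy]
    ring
  have hconst := Metric.isOpen_ball.is_const_of_deriv_eq_zero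
    (convex_ball (0 : ℂ) R).isPreconnected
    (fun y hy ↦ (hd y hy).differentiableAt.differentiableWithinAt)
    (fun y hy ↦ (hd y hy).deriv) hz (Metric.mem_ball_self hR)
  simp only [hq0, neg_zero, Complex.exp_zero, mul_one] at hconst
  rw [← hconst, mul_assoc, ← Complex.exp_add]
  simp

/-- A logarithm q of h/h(0) has real part at most M - log|h(0)|. Borel–Carathéodory bounds |q| on
|z| = R/2, and Cauchy's estimate bounds its derivative of order n + 1. -/
theorem norm_iteratedDeriv_logDeriv_le {h : ℂ → ℂ} {R M : ℝ} (hR : 0 < R)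
    (hh : DifferentiableOn ℂ h (Metric.ball 0 R)) (hne : ∀ z ∈ Metric.ball (0 : ℂ) R, h z ≠ 0)
    (hM : ∀ z ∈ Metric.ball (0 : ℂ) R, ‖h z‖ ≤ Real.exp M) (n : ℕ) :
    ‖iteratedDeriv n (logDeriv h) 0‖ ≤
      (n + 1).factorial * (2 * (|M| + |Real.log ‖h 0‖| + 1)) / (R / 2) ^ (n + 1) := by
  obtain ⟨q, hq0, hq, hhq⟩ := exists_eq_mul_exp hR hh hne
  -- The summand 1 makes the bound strictly positive, as Borel–Carathéodory requires.
  set A := |M| + |Real.log ‖h 0‖| + 1 with hA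
  have hA0 : 0 < A := by positivity
  have h00 : 0 < ‖h 0‖ := norm_pos_iff.2 (hne 0 (Metric.mem_ball_self hR))
  have hre : Set.MapsTo q (Metric.ball 0 R) {z | z.re ≤ A} := by
    intro z hz
    have h1 := hM z hz
    rw [hhq z hz, norm_mul, Complex.norm_exp, ← Real.exp_log h00, ← Real.exp_add,
      Real.exp_le_exp] at h1
    change (q z).re ≤ A
    have := le_abs_self M
    have := neg_abs_le (Real.log ‖h 0‖)
    linarith
  have hqd : DifferentiableOn ℂ q (Metric.ball 0 R) := fun z hz ↦
    (hq z hz).differentiableAt.differentiableWithinAt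
  have hev : logDeriv h =ᶠ[𝓝 0] deriv q := by
    filter_upwards [Metric.ball_mem_nhds 0 hR] with z hz using (hq z hz).deriv.symm
  rw [hev.iteratedDeriv_eq, ← iteratedDeriv_succ']
  refine Complex.norm_iteratedDeriv_le_of_forall_mem_sphere_norm_le (n + 1) (half_pos hR) ?_ ?_
  · refine (hqd.mono ?_).diffContOnCl
    rw [closure_ball _ (half_pos hR).ne']
    exact Metric.closedBall_subset_ball (half_lt_self hR)
  · intro z hz
    rw [mem_sphere_zero_iff_norm] at hz
    have h1 := Complex.borelCaratheodory_zero hA0 hqd hre hR (z := z)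
      (by rw [mem_ball_zero_iff, hz]; exact half_lt_self hR) hq0
    refine h1.trans (le_of_eq ?_)
    rw [hz]
    field_simp
    ring

open Polynomial in
theorem taylorFunctional_congr {f g : ℂ → ℂ} (h : f =ᶠ[𝓝 0] g) (p : ℂ[X]) :
    taylorFunctional f p = taylorFunctional g p := by
  have : taylorFunctional f = taylorFunctional g := by
    unfold taylorFunctional
    congr 1
    ext n
    simp [h.iteratedDeriv_eq]
  rw [this]

open Polynomial in
theorem taylorFunctional_add {f g : ℂ → ℂ} (hf : AnalyticAt ℂ f 0) (hg : AnalyticAt ℂ g 0)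
    (p : ℂ[X]) :
    taylorFunctional (f + g) p = taylorFunctional f p + taylorFunctional g p := by
  rw [← LinearMap.add_apply]
  congr 1
  refine Polynomial.lhom_ext' fun n ↦ LinearMap.ext_ring ?_
  simp only [LinearMap.comp_apply, Polynomial.monomial_one_right_eq_X_pow, LinearMap.add_apply,
    taylorFunctional_X_pow]
  rw [iteratedDeriv_add hf.contDiffAt hg.contDiffAt, mul_add]

open Polynomial in
-- From the geometric series: a zero w contributes a point mass at w⁻¹ to the moment functional.
theorem taylorFunctional_inv_sub {w : ℂ} (hw : w ≠ 0) (p : ℂ[X]) :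
    taylorFunctional (fun z ↦ (z - w)⁻¹) p = -w⁻¹ * p.eval w⁻¹ := by
  have : taylorFunctional (fun z ↦ (z - w)⁻¹) = (-w⁻¹) • Polynomial.leval w⁻¹ := by
    refine Polynomial.lhom_ext' fun n ↦ LinearMap.ext_ring ?_
    have hn : (n.factorial : ℂ) ≠ 0 := by exact_mod_cast n.factorial_ne_zero
    have h1 := congrFun (iter_deriv_inv_linear_sub n (1 : ℂ) w) 0
    simp only [one_mul, one_pow, mul_one] at h1
    simp only [LinearMap.comp_apply, Polynomial.monomial_one_right_eq_X_pow,
      taylorFunctional_X_pow, LinearMap.smul_apply, Polynomial.leval_apply, Polynomial.eval_pow,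
      Polynomial.eval_X, iteratedDeriv_eq_iterate, h1, smul_eq_mul, zero_sub]
    rw [show (-1 - n : ℤ) = -((n + 1 : ℕ) : ℤ) by push_cast; ring, zpow_neg, zpow_natCast,
      neg_pow w (n + 1), mul_inv, ← inv_pow (-1 : ℂ)]
    field_simp
    rw [← pow_add, show n + (n + 1) = 2 * n + 1 by ring, pow_succ, pow_mul, pow_succ w,
      div_pow, one_pow]
    field_simp
    norm_num
  rw [this]; simp

open Polynomial in
theorem taylorFunctional_logDeriv_zeroProd_nonpos {s : Multiset ℂ}
    (hs : ∀ w ∈ s, ∃ x : ℝ, 1 ≤ x ∧ w = x) (j k : ℕ) :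
    taylorFunctional (logDeriv (zeroProd s)) (X ^ k * (1 - X) ^ j) ≤ 0 := by
  induction s using Multiset.induction with
  | empty =>
    rw [funext zeroProd_zero, logDeriv_const]
    refine le_of_eq ?_
    have h0 : taylorFunctional 0 = 0 := by
      refine Polynomial.lhom_ext' fun n ↦ LinearMap.ext_ring ?_
      simp [Polynomial.monomial_one_right_eq_X_pow, taylorFunctional_X_pow]
    rw [h0, LinearMap.zero_apply]
  | cons w s ih =>
    obtain ⟨x, hx, rfl⟩ := hs w (Multiset.mem_cons_self _ _)
    have hx0 : (x : ℂ) ≠ 0 := by exact_mod_cast (zero_lt_one.trans_le hx).ne'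
    have hne : ∀ᶠ z in 𝓝 (0 : ℂ), z - (x : ℂ) ≠ 0 := by
      refine ContinuousAt.eventually_ne (by fun_prop) ?_
      simpa using hx0
    have hne' : ∀ᶠ z in 𝓝 (0 : ℂ), zeroProd s z ≠ 0 :=
      (differentiable_zeroProd s).continuous.continuousAt.eventually_ne (by simp)
    have heq : logDeriv (zeroProd ((x : ℂ) ::ₘ s)) =ᶠ[𝓝 0]
        (fun z : ℂ ↦ (z - (x : ℂ))⁻¹) + logDeriv (zeroProd s) := by
      filter_upwards [hne, hne'] with z hz hz'
      have h1 : (1 - z / x : ℂ) ≠ 0 := by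
        intro h; apply hz; field_simp at h; linear_combination -h
      rw [funext (zeroProd_cons _ _), logDeriv_mul z h1 hz' (by fun_prop)
        (differentiable_zeroProd s z), Pi.add_apply]
      congr 1
      rw [logDeriv_apply, deriv_const_sub, deriv_div_const, deriv_id'']
      rw [inv_eq_one_div (z - (x : ℂ)), div_eq_div_iff h1 hz]
      field_simp
      ring
    have hinv : AnalyticAt ℂ (fun z : ℂ ↦ (z - (x : ℂ))⁻¹) 0 :=
      AnalyticAt.fun_inv (by fun_prop) (by simpa using hx0)
    rw [taylorFunctional_congr heq, taylorFunctional_add hinv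
      (analyticAt_logDeriv (differentiable_zeroProd s) (by simp)),
      taylorFunctional_inv_sub hx0]
    refine add_nonpos ?_ (ih fun v hv ↦ hs v (Multiset.mem_cons_of_mem hv))
    have hx1 : 0 ≤ 1 - x⁻¹ := sub_nonneg.2 (inv_le_one_of_one_le₀ hx)
    have hxp : 0 ≤ x⁻¹ := inv_nonneg.2 (zero_le_one.trans hx)
    have : -(x : ℂ)⁻¹ * (X ^ k * (1 - X) ^ j : ℂ[X]).eval (x : ℂ)⁻¹ =
        ((-(x⁻¹ * (x⁻¹ ^ k * (1 - x⁻¹) ^ j)) : ℝ) : ℂ) := by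
      simp
    rw [this]
    have h2 : -(x⁻¹ * (x⁻¹ ^ k * (1 - x⁻¹) ^ j)) ≤ 0 := neg_nonpos.2 (by positivity)
    exact_mod_cast h2

open Polynomial Filter in
theorem tendsto_taylorFunctional_zero {g : ℕ → ℂ → ℂ}
    (hg : ∀ i, Tendsto (fun n ↦ iteratedDeriv i (g n) 0) atTop (𝓝 0)) (p : ℂ[X]) :
    Tendsto (fun n ↦ taylorFunctional (g n) p) atTop (𝓝 0) := by
  induction p using Polynomial.induction_on' with
  | add p q hp hq => simpa using hp.add hq
  | monomial i a =>
    have : ∀ n, taylorFunctional (g n) (monomial i a) =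
        a * ((i.factorial : ℂ)⁻¹ * iteratedDeriv i (g n) 0) := by
      intro n
      rw [← taylorFunctional_X_pow, ← smul_eq_mul, ← map_smul, smul_X_eq_monomial]
    simp only [this]
    simpa using ((hg i).const_mul _).const_mul a

open Polynomial Filter in
/-- If the zeros of an entire function of small growth lie in `[1, ∞)`, then all the sign
conditions on its logarithmic derivative at `0` hold. -/
theorem iteratedDeriv_nonpos_of_zeros {F : ℂ → ℂ} (hF : Differentiable ℂ F) (hF0 : F 0 ≠ 0)
    (hz : ∀ w, F w = 0 → ∃ x : ℝ, 1 ≤ x ∧ w = x) {R M : ℕ → ℝ} (hR : Tendsto R atTop atTop)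
    (hM : ∀ n z, ‖z‖ ≤ 2 * R n → ‖F z‖ ≤ Real.exp (M n))
    (hMR : Tendsto (fun n ↦ M n / R n) atTop (𝓝 0)) (j k : ℕ) :
    iteratedDeriv (j + k) (fun z ↦ (z - 1) ^ j * logDeriv F z) 0 ≤ 0 := by
  have hFa : AnalyticAt ℂ (logDeriv F) 0 := analyticAt_logDeriv hF hF0
  rw [iteratedDeriv_sub_one_pow_mul hFa]
  refine mul_nonpos_of_nonneg_of_nonpos (by exact_mod_cast Nat.zero_le _) ?_
  -- Split F = P·h, with P built from the zeros in the ball of radius R n. The factor P contributes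
  -- the right sign. Each factor of P has modulus at least 1 on |z| = 2 R n, so h inherits the bound
  -- for F, and the coefficients of h'/h are O((|M n| + 1)/(R n)^(i+1)), which tends to 0.
  have hex : ∀ n, ∃ h : ℂ → ℂ, 0 < R n →
      taylorFunctional (logDeriv F) (X ^ k * (1 - X) ^ j) -
        taylorFunctional (logDeriv h) (X ^ k * (1 - X) ^ j) ≤ 0 ∧
      ∀ i, ‖iteratedDeriv i (logDeriv h) 0‖ ≤ (i + 1).factorial *
        (2 * (|M n| + |Real.log ‖F 0‖| + 1)) / (R n / 2) ^ (i + 1) := by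
    intro n
    by_cases hRn : 0 < R n
    swap
    · exact ⟨0, fun h ↦ absurd h hRn⟩
    obtain ⟨s, h, hh, hs, hFh, hne⟩ := exists_eq_zeroProd_mul hF hF0 hRn
    have h0 : h 0 = F 0 := by rw [hFh]; simp
    refine ⟨h, fun _ ↦ ⟨?_, ?_⟩⟩
    · have hsum : logDeriv F =ᶠ[𝓝 0] logDeriv (zeroProd s) + logDeriv h := by
        have h1 : ∀ᶠ z in 𝓝 (0 : ℂ), zeroProd s z ≠ 0 :=
          (differentiable_zeroProd s).continuous.continuousAt.eventually_ne (by simp)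
        filter_upwards [h1, Metric.ball_mem_nhds 0 hRn] with z hz1 hz2
        rw [funext hFh, logDeriv_mul z hz1 (hne z hz2) (differentiable_zeroProd s z) (hh z)]
        rfl
      rw [taylorFunctional_congr hsum, taylorFunctional_add
        (analyticAt_logDeriv (differentiable_zeroProd s) (by simp))
        (analyticAt_logDeriv hh (by rwa [h0])), add_sub_cancel_right]
      exact taylorFunctional_logDeriv_zeroProd_nonpos (fun w hw ↦ hz w (hs w hw).1) j k
    · intro i
      rw [← h0]
      refine norm_iteratedDeriv_logDeriv_le hRn hh.differentiableOn hne (fun z hz ↦ ?_) i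
      have hs' : ∀ w ∈ s, w ≠ 0 ∧ ‖w‖ ≤ R n := fun w hw ↦
        ⟨by rintro rfl; exact hF0 (hs 0 hw).1, (hs w hw).2.le⟩
      have := norm_le_div_pow_of_eq_zeroProd_mul hh hFh one_pos hRn hs'
        (fun z hz ↦ hM n z (by linarith)) (z := z)
        (by rw [mem_ball_zero_iff] at hz; linarith)
      simpa using this
  choose h hh using hex
  have hpos : ∀ᶠ n in atTop, 1 ≤ R n := hR.eventually_ge_atTop 1
  have hlim : Tendsto (fun n ↦ taylorFunctional (logDeriv (h n)) (X ^ k * (1 - X) ^ j)) atTop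
      (𝓝 0) := by
    refine tendsto_taylorFunctional_zero (fun i ↦ ?_) _
    refine squeeze_zero_norm' (a := fun n ↦ ((i + 1).factorial * 2 * 2 ^ (i + 1)) *
      (|M n / R n| + (|Real.log ‖F 0‖| + 1) * (R n)⁻¹)) ?_ ?_
    · filter_upwards [hpos] with n hn
      have hRn : 0 < R n := by linarith
      refine ((hh n hRn).2 i).trans ?_
      rw [abs_div, abs_of_pos hRn, div_pow, div_div_eq_mul_div, div_le_iff₀ (by positivity)]
      have h1 : R n ≤ R n ^ (i + 1) := le_self_pow₀ hn (by omega)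
      calc ((i + 1).factorial : ℝ) * (2 * (|M n| + |Real.log ‖F 0‖| + 1)) * 2 ^ (i + 1)
          = ((i + 1).factorial * 2 * 2 ^ (i + 1)) *
            (|M n| / R n + (|Real.log ‖F 0‖| + 1) * (R n)⁻¹) * R n := by
            field_simp
            ring
        _ ≤ _ := by gcongr
    · have h1 : Tendsto (fun n ↦ |M n / R n|) atTop (𝓝 0) := by simpa using hMR.abs
      have h2 : Tendsto (fun n ↦ (|Real.log ‖F 0‖| + 1) * (R n)⁻¹) atTop (𝓝 0) := by
        simpa using (tendsto_inv_atTop_zero.comp hR).const_mul (|Real.log ‖F 0‖| + 1)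
      simpa using (h1.add h2).const_mul (((i + 1).factorial : ℝ) * 2 * 2 ^ (i + 1))
  have hlim' := (tendsto_const_nhds
    (x := taylorFunctional (logDeriv F) (X ^ k * (1 - X) ^ j))).sub hlim
  rw [sub_zero] at hlim'
  refine le_of_tendsto hlim' ?_
  filter_upwards [hpos] with n hn
  exact (hh n (by linarith)).1

/-! ### The theta function of a character and its Mellin transform -/

theorem hasSum_int_of_residue {m : ℕ} [NeZero m] {f : ℤ → ℂ} {S : ZMod m → ℂ}
    (h : ∀ j : ZMod m, HasSum (fun n : ℤ ↦ f (n * m + j.val)) (S j)) : HasSum f (∑ j, S j) := by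
  have hm : (m : ℤ) ≠ 0 := by exact_mod_cast NeZero.ne m
  have h1 : ∀ j : ZMod m, HasSum (fun N : ℤ ↦ if (N : ZMod m) = j then f N else 0) (S j) := by
    intro j
    have hinj : Function.Injective fun n : ℤ ↦ n * m + (j.val : ℤ) := fun a b hab ↦
      mul_right_cancel₀ hm (add_right_cancel hab)
    refine (hinj.hasSum_iff (fun N hN ↦ if_neg fun hNj ↦ hN ?_)).1 ((h j).congr_fun fun n ↦ ?_)
    · have : ((N - j.val : ℤ) : ZMod m) = 0 := by simp [hNj]
      obtain ⟨c, hc⟩ := (ZMod.intCast_zmod_eq_zero_iff_dvd _ m).1 this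
      exact ⟨c, by simp only; linarith⟩
    · simp
  refine (hasSum_sum fun j _ ↦ h1 j).congr_fun fun N ↦ ?_
  simp

theorem hasMellin_sum {ι : Type*} (s : Finset ι) (c : ι → ℂ) {g : ι → ℝ → ℂ} {w : ℂ} {v : ι → ℂ}
    (h : ∀ i ∈ s, HasMellin (g i) w (v i)) :
    HasMellin (fun x ↦ ∑ i ∈ s, c i * g i x) w (∑ i ∈ s, c i * v i) := by
  have hfun : ∀ t : ℝ, (t : ℂ) ^ (w - 1) • ∑ i ∈ s, c i * g i t =
      ∑ i ∈ s, c i * ((t : ℂ) ^ (w - 1) • g i t) := by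
    intro t
    rw [Finset.smul_sum]
    exact Finset.sum_congr rfl fun i _ ↦ by simp only [smul_eq_mul]; ring
  have hint : ∀ i ∈ s, MeasureTheory.IntegrableOn
      (fun t : ℝ ↦ c i * ((t : ℂ) ^ (w - 1) • g i t)) (Set.Ioi 0) := fun i hi ↦
    (h i hi).1.const_mul (c i)
  constructor
  · simp only [MellinConvergent, hfun]
    exact MeasureTheory.integrable_finsetSum s hint
  · simp only [mellin, hfun]
    rw [MeasureTheory.integral_finsetSum s hint]
    refine Finset.sum_congr rfl fun i hi ↦ ?_
    rw [MeasureTheory.integral_const_mul, ← (h i hi).2]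
    rfl

open HurwitzZeta ZMod in
/-- The theta function of an even function on `ZMod m`. -/
noncomputable def evenTheta {m : ℕ} [NeZero m] (Φ : ZMod m → ℂ) (x : ℝ) : ℂ :=
  ∑ j, Φ j * (evenKernel (toAddCircle j) x : ℂ)

open HurwitzZeta ZMod in
/-- The theta function of an odd function on `ZMod m`. -/
noncomputable def oddTheta {m : ℕ} [NeZero m] (Φ : ZMod m → ℂ) (x : ℝ) : ℂ :=
  ∑ j, Φ j * (oddKernel (toAddCircle j) x : ℂ)

open HurwitzZeta ZMod in
-- The odd Hurwitz kernels decay at both ends, so the Mellin integral converges for every s and no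
-- continuation is needed.
theorem hasMellin_oddTheta {m : ℕ} [NeZero m] {Φ : ZMod m → ℂ} (hΦ : Φ.Odd) (s : ℂ) :
    HasMellin (oddTheta Φ) ((s + 1) / 2) (2 * (m : ℂ) ^ s * completedLFunction Φ s) := by
  have h := hasMellin_sum Finset.univ Φ (w := (s + 1) / 2) fun j _ ↦
    (isStrong_hurwitzOddFEPair (toAddCircle j)).hasMellin ((s + 1) / 2)
  have hm : (m : ℂ) ≠ 0 := by exact_mod_cast NeZero.ne m
  have hv : 2 * (m : ℂ) ^ s * completedLFunction Φ s =
      ∑ j, Φ j * (hurwitzOddFEPair (toAddCircle j)).Λ ((s + 1) / 2) := by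
    rw [completedLFunction_def_odd hΦ, Complex.cpow_neg, ← mul_assoc, mul_assoc 2,
      mul_inv_cancel₀ (by simp [Complex.cpow_eq_zero_iff, hm]), mul_one, Finset.mul_sum]
    refine Finset.sum_congr rfl fun j _ ↦ ?_
    rw [completedHurwitzZetaOdd]
    ring
  rw [hv]
  exact h

open HurwitzZeta ZMod in
/-- The pair of theta functions attached to a function on `ZMod m` that vanishes at `0` and has
mean zero. -/
noncomputable def evenThetaPair {m : ℕ} [NeZero m] (Φ : ZMod m → ℂ) (h0 : Φ 0 = 0)
    (hsum : ∑ j, Φ j = 0) : WeakFEPair ℂ where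
  f := evenTheta Φ
  g x := ∑ j, Φ j * (hurwitzEvenFEPair (toAddCircle j)).g x
  k := 1 / 2
  ε := 1
  f₀ := 0
  g₀ := 0
  hf_int := by
    refine ContinuousOn.locallyIntegrableOn ?_ measurableSet_Ioi
    exact continuousOn_finsetSum _ fun j _ ↦ continuousOn_const.mul
      (Complex.continuous_ofReal.comp_continuousOn (continuousOn_evenKernel _))
  hg_int := by
    refine ContinuousOn.locallyIntegrableOn ?_ measurableSet_Ioi
    exact continuousOn_finsetSum _ fun j _ ↦ continuousOn_const.mul
      (Complex.continuous_ofReal.comp_continuousOn (continuousOn_cosKernel _))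
  hk := by norm_num
  hε := one_ne_zero
  h_feq x hx := by
    simp only [evenTheta, Finset.smul_sum]
    refine Finset.sum_congr rfl fun j _ ↦ ?_
    have h1 : ((evenKernel (toAddCircle j) (1 / x) : ℝ) : ℂ) = _ :=
      (hurwitzEvenFEPair (toAddCircle j)).h_feq x hx
    rw [h1]
    simp only [smul_eq_mul, hurwitzEvenFEPair]
    ring
  -- Only j = 0 has a constant term in the even kernel, and Φ 0 = 0 removes it. Every cosine kernel
  -- has the same constant term, removed by the vanishing sum of Φ.
  hf_top r := by
    have h1 : (fun x ↦ evenTheta Φ x - 0) = fun x ↦ ∑ j, Φ j *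
        ((hurwitzEvenFEPair (toAddCircle j)).f x - (hurwitzEvenFEPair (toAddCircle j)).f₀) := by
      ext x
      simp [evenTheta, hurwitzEvenFEPair, mul_sub, Finset.sum_sub_distrib, h0]
    rw [h1]
    exact Asymptotics.IsBigO.fun_sum fun j _ ↦ ((hurwitzEvenFEPair _).hf_top r).const_mul_left _
  hg_top r := by
    have h1 : (fun x ↦ ∑ j, Φ j * (hurwitzEvenFEPair (toAddCircle j)).g x - 0) = fun x ↦ ∑ j, Φ j *
        ((hurwitzEvenFEPair (toAddCircle j)).g x - (hurwitzEvenFEPair (toAddCircle j)).g₀) := by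
      ext x
      simp [hurwitzEvenFEPair, mul_sub, Finset.sum_sub_distrib, hsum]
    rw [h1]
    exact Asymptotics.IsBigO.fun_sum fun j _ ↦ ((hurwitzEvenFEPair _).hg_top r).const_mul_left _

open HurwitzZeta ZMod in
theorem hasMellin_evenTheta {m : ℕ} [NeZero m] {Φ : ZMod m → ℂ} (hΦ : Φ.Even) (h0 : Φ 0 = 0)
    (hsum : ∑ j, Φ j = 0) (s : ℂ) :
    HasMellin (evenTheta Φ) (s / 2) (2 * (m : ℂ) ^ s * completedLFunction Φ s) := by
  set P := evenThetaPair Φ h0 hsum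
  have hP : IsStrongFEPair P := ⟨rfl, rfl⟩
  have hm : (m : ℂ) ≠ 0 := by exact_mod_cast NeZero.ne m
  have hre : ∀ s : ℂ, 1 < s.re → P.Λ (s / 2) = 2 * (m : ℂ) ^ s * completedLFunction Φ s := by
    intro s hs
    have h := hasMellin_sum Finset.univ Φ (w := s / 2) fun j _ ↦
      (hurwitzEvenFEPair (toAddCircle j)).hasMellin (s := s / 2) (by
        simp only [hurwitzEvenFEPair]
        rw [show s / 2 = ((1 / 2 : ℝ) : ℂ) * s by push_cast; ring, Complex.re_ofReal_mul]
        linarith)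
    have h1 : P.f = fun x ↦ ∑ j, Φ j *
        ((hurwitzEvenFEPair (toAddCircle j)).f x - (hurwitzEvenFEPair (toAddCircle j)).f₀) := by
      ext x
      simp [P, evenThetaPair, evenTheta, hurwitzEvenFEPair, mul_sub, Finset.sum_sub_distrib, h0]
    rw [← (hP.hasMellin (s / 2)).2, h1, h.2, completedLFunction_def_even hΦ, Complex.cpow_neg,
      ← mul_assoc, mul_assoc 2, mul_inv_cancel₀ (by simp [Complex.cpow_eq_zero_iff, hm]), mul_one,
      Finset.mul_sum]
    refine Finset.sum_congr rfl fun j _ ↦ ?_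
    rw [completedHurwitzZetaEven]
    ring
  have hd1 : Differentiable ℂ fun s : ℂ ↦ P.Λ (s / 2) :=
    hP.differentiable_Λ.comp (differentiable_id.div_const 2)
  have hd2 : Differentiable ℂ fun s : ℂ ↦ 2 * (m : ℂ) ^ s * completedLFunction Φ s := by
    have := differentiable_completedLFunction h0 hsum
    have hpow : Differentiable ℂ fun s : ℂ ↦ (m : ℂ) ^ s := fun s ↦
      differentiableAt_id.const_cpow (Or.inl hm)
    exact (hpow.const_mul 2).mul this
  -- For a single residue class the Mellin formula holds only for Re s > 1. Both sides of the summed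
  -- identity are entire, so it extends to all s.
  have heq := AnalyticOnNhd.eq_of_eventuallyEq (z₀ := (2 : ℂ))
    (fun z _ ↦ hd1.analyticAt z) (fun z _ ↦ hd2.analyticAt z) (by
      have : {s : ℂ | 1 < s.re} ∈ 𝓝 (2 : ℂ) :=
        (isOpen_lt continuous_const Complex.continuous_re).mem_nhds (by simp)
      filter_upwards [this] with s hs using hre s hs)
  rw [← congrFun heq s]
  exact hP.hasMellin (s / 2)

open HurwitzZeta ZMod in
theorem hasSum_evenTheta {m : ℕ} [NeZero m] (Φ : ZMod m → ℂ) {x : ℝ} (hx : 0 < x) :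
    HasSum (fun n : ℤ ↦ Φ n * (Real.exp (-(Real.pi * ((n : ℝ) / m) ^ 2 * x)) : ℂ))
      (evenTheta Φ x) := by
  have hm : (m : ℝ) ≠ 0 := by exact_mod_cast NeZero.ne m
  refine hasSum_int_of_residue fun j ↦ ?_
  have h := (Complex.hasSum_ofReal.2 (hasSum_int_evenKernel ((j.val : ℝ) / m) hx)).mul_left (Φ j)
  rw [← toAddCircle_apply] at h
  refine h.congr_fun fun n ↦ ?_
  have h1 : (((n * m + j.val : ℤ) : ℝ) / m) = n + (j.val : ℝ) / m := by
    push_cast; field_simp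
  rw [h1]
  simp

open HurwitzZeta ZMod in
theorem hasSum_oddTheta {m : ℕ} [NeZero m] (Φ : ZMod m → ℂ) {x : ℝ} (hx : 0 < x) :
    HasSum (fun n : ℤ ↦ (n / m : ℂ) * Φ n * (Real.exp (-(Real.pi * ((n : ℝ) / m) ^ 2 * x)) : ℂ))
      (oddTheta Φ x) := by
  have hm : (m : ℝ) ≠ 0 := by exact_mod_cast NeZero.ne m
  refine hasSum_int_of_residue fun j ↦ ?_
  have h := (Complex.hasSum_ofReal.2 (hasSum_int_oddKernel ((j.val : ℝ) / m) hx)).mul_left (Φ j)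
  rw [← toAddCircle_apply] at h
  refine h.congr_fun fun n ↦ ?_
  have h1 : (((n * m + j.val : ℤ) : ℝ) / m) = n + (j.val : ℝ) / m := by
    push_cast; field_simp
  have h2 : (((n * m + j.val : ℤ) : ℂ) / m) = ((n + (j.val : ℝ) / m : ℝ) : ℂ) := by
    rw [← h1]; push_cast; rfl
  rw [h1, h2]
  simp
  ring

/-- If the kernel `phi` is nonnegative, then a positive multiple of `Xi` is the Mellin transform of a
nonnegative function. -/
theorem exists_hasMellin_Xi {m : ℕ} [NeZero m] {χ : DirichletCharacter ℂ m} (hχ : χ ≠ 1)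
    (hphi : ∀ t : ℝ, 0 ≤ phi χ t) :
    ∃ (θ : ℝ → ℂ) (c : ℝ), 0 < c ∧ (∀ x, 0 < x → 0 ≤ θ x) ∧
      ∀ z, HasMellin θ ((1 + 2 * (parity χ : ℂ) + 2 * Complex.I * z) / 4) (c * Xi χ z) := by
  have hm0 : (0 : ℝ) < m := by exact_mod_cast Nat.pos_of_ne_zero (NeZero.ne m)
  have hmc : (m : ℂ) ≠ 0 := by exact_mod_cast NeZero.ne m
  have hm1 : m ≠ 1 := by
    rintro rfl
    exact hχ (DirichletCharacter.level_one χ)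
  suffices H : ∃ θ : ℝ → ℂ, (∀ t : ℝ, phi χ t = Real.exp (-((1 + 2 * (parity χ : ℝ)) / 2 * t)) *
      (m : ℂ) ^ parity χ * θ (m / Real.exp (2 * t))) ∧ ∀ s : ℂ, HasMellin θ ((s + parity χ) / 2)
      (2 * (m : ℂ) ^ s * χ.completedLFunction s) by
    obtain ⟨θ, hθ, hM⟩ := H
    -- The substitution x = e^(-2t) turns φ into a positive multiple of θ(mx). Rescaling by m
    -- multiplies the transform by m^(-(s+a)/2), and m^s · m^(-(s+a)/2) = m^(-a) · m^((s+a)/2).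
    refine ⟨fun x ↦ θ (m * x), 2 * (m : ℝ) ^ (-(parity χ : ℝ)), by positivity, ?_, ?_⟩
    · intro x hx
      have h1 := hphi (-(Real.log x) / 2)
      rw [hθ] at h1
      have h2 : (m : ℝ) / Real.exp (2 * (-(Real.log x) / 2)) = m * x := by
        rw [show 2 * (-(Real.log x) / 2) = -Real.log x by ring, Real.exp_neg, Real.exp_log hx]
        field_simp
      rw [h2] at h1
      set D : ℝ := Real.exp (-((1 + 2 * (parity χ : ℝ)) / 2 * (-(Real.log x) / 2))) *
        (m : ℝ) ^ parity χ with hD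
      have hD0 : 0 < D := by positivity
      have hDc : (D : ℂ) ≠ 0 := by exact_mod_cast hD0.ne'
      have h3 : (0 : ℂ) ≤ ((D⁻¹ : ℝ) : ℂ) := Complex.zero_le_real.2 (inv_pos.2 hD0).le
      have h4 := mul_nonneg h3 h1
      rwa [show (m : ℂ) ^ parity χ = (((m : ℝ) ^ parity χ : ℝ) : ℂ) by push_cast; rfl,
        ← Complex.ofReal_mul, ← hD, ← mul_assoc, Complex.ofReal_inv, inv_mul_cancel₀ hDc,
        one_mul] at h4
    · intro z
      have h := hM ((1 + 2 * Complex.I * z) / 2)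
      set s := (1 + 2 * Complex.I * z) / 2 with hs
      have hw : (1 + 2 * (parity χ : ℂ) + 2 * Complex.I * z) / 4 = (s + parity χ) / 2 := by
        rw [hs]; ring
      rw [hw]
      refine ⟨(MellinConvergent.comp_mul_left hm0).2 h.1, ?_⟩
      rw [mellin_comp_mul_left _ _ hm0, h.2, Xi, ← hs, hw, smul_eq_mul]
      push_cast
      rw [Complex.ofReal_cpow hm0.le]
      push_cast
      have e1 : (m : ℂ) ^ s = (m : ℂ) ^ ((s + parity χ) / 2) * (m : ℂ) ^ ((s + parity χ) / 2) *
          (m : ℂ) ^ (-(parity χ : ℂ)) := by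
        rw [← Complex.cpow_add _ _ hmc, ← Complex.cpow_add _ _ hmc]
        congr 1; ring
      have e2 : (m : ℂ) ^ (-((s + parity χ) / 2)) * (m : ℂ) ^ ((s + parity χ) / 2) = 1 := by
        rw [← Complex.cpow_add _ _ hmc]; simp
      rw [e1]
      linear_combination (2 * (m : ℂ) ^ ((s + parity χ) / 2) * (m : ℂ) ^ (-(parity χ : ℂ)) *
        χ.completedLFunction s) * e2
  rcases χ.even_or_odd with h | h
  · have ha : parity χ = 0 := if_pos h
    refine ⟨evenTheta χ, fun t ↦ ?_, fun s ↦ ?_⟩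
    · rw [phi, ha]
      have hx : 0 < (m : ℝ) / Real.exp (2 * t) := by positivity
      refine HasSum.tsum_eq ?_
      refine ((hasSum_evenTheta χ hx).mul_left _).congr_fun fun n ↦ ?_
      have : -(((n : ℝ) ^ 2 * Real.pi / (m * Real.exp (2 * t)))) - (1 + 2 * ((0 : ℕ) : ℝ)) / 2 * t =
          -((1 + 2 * ((0 : ℕ) : ℝ)) / 2 * t) +
          -(Real.pi * ((n : ℝ) / m) ^ 2 * (m / Real.exp (2 * t))) := by
        field_simp
        ring
      rw [this, Real.exp_add]
      push_cast
      ring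
    · rw [ha]
      simpa [DirichletCharacter.completedLFunction] using hasMellin_evenTheta h.to_fun (χ.map_zero' hm1) (χ.sum_eq_zero_of_ne_one hχ) s
  · have ha : parity χ = 1 := by
      refine if_neg ?_
      rw [show χ (-1) = -1 from h]
      norm_num
    refine ⟨oddTheta χ, fun t ↦ ?_, fun s ↦ ?_⟩
    · rw [phi, ha]
      have hx : 0 < (m : ℝ) / Real.exp (2 * t) := by positivity
      refine HasSum.tsum_eq ?_
      refine ((hasSum_oddTheta χ hx).mul_left _).congr_fun fun n ↦ ?_
      have : -(((n : ℝ) ^ 2 * Real.pi / (m * Real.exp (2 * t)))) - (1 + 2 * ((1 : ℕ) : ℝ)) / 2 * t =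
          -((1 + 2 * ((1 : ℕ) : ℝ)) / 2 * t) +
          -(Real.pi * ((n : ℝ) / m) ^ 2 * (m / Real.exp (2 * t))) := by
        field_simp
        ring
      rw [this, Real.exp_add]
      push_cast
      field_simp
    · rw [ha]
      simpa [DirichletCharacter.completedLFunction] using hasMellin_oddTheta h.to_fun s

/-! ### Mellin transforms of nonnegative functions -/

open MeasureTheory in
/-- The integral dominating the Mellin transform on a vertical line. -/
noncomputable def absMellin (θ : ℝ → ℂ) (u : ℝ) : ℝ := ∫ x in Set.Ioi (0 : ℝ), x ^ (u - 1) * ‖θ x‖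

theorem norm_cpow_smul {θ : ℝ → ℂ} {x : ℝ} (hx : 0 < x) (w : ℂ) :
    ‖(x : ℂ) ^ (w - 1) • θ x‖ = x ^ (w.re - 1) * ‖θ x‖ := by
  rw [norm_smul, Complex.norm_cpow_eq_rpow_re_of_pos hx]
  simp

open MeasureTheory in
theorem norm_mellin_le (θ : ℝ → ℂ) (w : ℂ) : ‖mellin θ w‖ ≤ absMellin θ w.re := by
  refine (norm_integral_le_integral_norm _).trans (le_of_eq ?_)
  exact setIntegral_congr_fun measurableSet_Ioi fun x hx ↦ norm_cpow_smul hx w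

open MeasureTheory in
theorem mellin_ofReal_eq_absMellin {θ : ℝ → ℂ} (hθ : ∀ x, 0 < x → 0 ≤ θ x) (u : ℝ) :
    mellin θ u = absMellin θ u := by
  rw [absMellin, ← integral_complex_ofReal]
  refine setIntegral_congr_fun measurableSet_Ioi fun x hx ↦ ?_
  simp only [smul_eq_mul, Complex.ofReal_mul]
  rw [← Complex.eq_coe_norm_of_nonneg (hθ x hx), Complex.ofReal_cpow (le_of_lt hx)]
  push_cast
  rfl

open MeasureTheory in
theorem integrableOn_absMellin {θ : ℝ → ℂ} {u : ℝ} (h : MellinConvergent θ u) :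
    IntegrableOn (fun x : ℝ ↦ x ^ (u - 1) * ‖θ x‖) (Set.Ioi 0) :=
  IntegrableOn.congr_fun h.norm (fun _ hx ↦ norm_cpow_smul hx u) measurableSet_Ioi

open MeasureTheory in
-- Pointwise x^(c-1) ≤ x^(a-1) + x^(b-1): the first term dominates for x ≤ 1, the second for x ≥ 1.
theorem absMellin_le_add {θ : ℝ → ℂ} {a c b : ℝ} (ha : MellinConvergent θ a)
    (hc : MellinConvergent θ c) (hb : MellinConvergent θ b) (hac : a ≤ c) (hcb : c ≤ b) :
    absMellin θ c ≤ absMellin θ a + absMellin θ b := by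
  rw [absMellin, absMellin, absMellin,
    ← integral_add (integrableOn_absMellin ha) (integrableOn_absMellin hb)]
  refine setIntegral_mono_on (integrableOn_absMellin hc)
    ((integrableOn_absMellin ha).add (integrableOn_absMellin hb)) measurableSet_Ioi fun x hx ↦ ?_
  have hx0 : 0 < x := hx
  rw [← add_mul]
  refine mul_le_mul_of_nonneg_right ?_ (norm_nonneg _)
  rcases le_total x 1 with h | h
  · exact (Real.rpow_le_rpow_of_exponent_ge hx0 h (by linarith)).trans
      (le_add_of_nonneg_right (Real.rpow_nonneg hx0.le _))
  · exact (Real.rpow_le_rpow_of_exponent_le h (by linarith)).trans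
      (le_add_of_nonneg_left (Real.rpow_nonneg hx0.le _))

open MeasureTheory in
theorem absMellin_eq_zero_of_eq_zero {θ : ℝ → ℂ} {u : ℝ} (hu : MellinConvergent θ u)
    (h : absMellin θ u = 0) (v : ℝ) : absMellin θ v = 0 := by
  rw [absMellin, setIntegral_eq_zero_iff_of_nonneg_ae ?_ (integrableOn_absMellin hu)] at h
  · have : (fun x : ℝ ↦ x ^ (v - 1) * ‖θ x‖) =ᵐ[volume.restrict (Set.Ioi 0)] 0 := by
      filter_upwards [h, ae_restrict_mem measurableSet_Ioi] with x hx hx0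
      have hx0' : (0 : ℝ) < x := hx0
      have : ‖θ x‖ = 0 := by
        rcases mul_eq_zero.1 hx with h | h
        · exact absurd h (Real.rpow_pos_of_pos hx0' _).ne'
        · exact h
      simp [this]
    rw [absMellin, integral_congr_ae this]
    simp
  · filter_upwards [ae_restrict_mem measurableSet_Ioi] with x hx
    have hx0 : (0 : ℝ) < x := hx
    exact mul_nonneg (Real.rpow_nonneg hx0.le _) (norm_nonneg _)

section

variable {θ : ℝ → ℂ} {b : ℝ} {X : ℂ → ℂ} (hθ : ∀ x, 0 < x → 0 ≤ θ x)
  (hX : ∀ z, HasMellin θ ((b + 2 * Complex.I * z) / 4) (X z))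

theorem add_two_mul_I_mul_div_four_re (b : ℝ) (z : ℂ) :
    (((b : ℂ) + 2 * Complex.I * z) / 4).re = (b - 2 * z.im) / 4 := by
  rw [show ((b : ℂ) + 2 * Complex.I * z) / 4 = ((1 / 4 : ℝ) : ℂ) * (b + 2 * Complex.I * z) by
    push_cast; ring, Complex.re_ofReal_mul]
  simp
  ring

theorem add_two_mul_I_mul_mul_I_div_four (b y : ℝ) :
    ((b : ℂ) + 2 * Complex.I * (y * Complex.I)) / 4 = (((b - 2 * y) / 4 : ℝ) : ℂ) := by
  push_cast
  linear_combination (y / 2 : ℂ) * Complex.I_mul_I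

include hX

theorem mellinConvergent_ofReal (y : ℝ) : MellinConvergent θ (((b - 2 * y) / 4 : ℝ) : ℂ) := by
  rw [← add_two_mul_I_mul_mul_I_div_four]
  exact (hX _).1

include hθ

theorem norm_mul_I_eq_absMellin (y : ℝ) :
    ‖X (y * Complex.I)‖ = absMellin θ ((b - 2 * y) / 4) := by
  have h := (hX (y * Complex.I)).2
  rw [add_two_mul_I_mul_mul_I_div_four, mellin_ofReal_eq_absMellin hθ] at h
  rw [← h, Complex.norm_real, Real.norm_of_nonneg]
  exact MeasureTheory.setIntegral_nonneg measurableSet_Ioi fun x hx ↦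
    mul_nonneg (Real.rpow_nonneg (le_of_lt hx) _) (norm_nonneg _)

/-- On each horizontal line |X| is largest on the imaginary axis, where the integrand is
nonnegative; `absMellin_le_add` then compares with the edges of the strip. -/
theorem norm_le_norm_add_norm {z : ℂ} {r : ℝ} (hz : |z.im| ≤ r) :
    ‖X z‖ ≤ ‖X (r * Complex.I)‖ + ‖X (-(r * Complex.I))‖ := by
  have h1 : ‖X z‖ ≤ absMellin θ ((b - 2 * z.im) / 4) := by
    rw [← (hX z).2, ← add_two_mul_I_mul_div_four_re]
    exact norm_mellin_le _ _
  have h2 := norm_mul_I_eq_absMellin hθ hX (-r)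
  rw [Complex.ofReal_neg, neg_mul] at h2
  rw [norm_mul_I_eq_absMellin hθ hX, h2]
  obtain ⟨hl, hr⟩ := abs_le.1 hz
  exact h1.trans (absMellin_le_add (mellinConvergent_ofReal hX _) (mellinConvergent_ofReal hX _)
    (mellinConvergent_ofReal hX _) (by linarith) (by linarith))

/-- A nonnegative integrand with zero integral vanishes almost everywhere, so θ does. -/
theorem mul_I_eq_zero_of_apply_zero_eq_zero (h0 : X 0 = 0) (y : ℝ) : X (y * Complex.I) = 0 := by
  have h1 := norm_mul_I_eq_absMellin hθ hX 0
  simp only [Complex.ofReal_zero, zero_mul, h0, norm_zero] at h1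
  rw [← norm_eq_zero, norm_mul_I_eq_absMellin hθ hX]
  exact absMellin_eq_zero_of_eq_zero (mellinConvergent_ofReal hX 0) h1.symm _

end

/-! ### Properties of `Xi` -/

section

variable {m : ℕ} [NeZero m] {χ : DirichletCharacter ℂ m}

theorem Xi_eq_zero_iff (z : ℂ) :
    Xi χ z = 0 ↔ χ.completedLFunction ((1 + 2 * Complex.I * z) / 2) = 0 := by
  have hm : (m : ℂ) ≠ 0 := by exact_mod_cast NeZero.ne m
  simp [Xi, Complex.cpow_eq_zero_iff, hm]

theorem differentiable_Xi (hχ : χ ≠ 1) : Differentiable ℂ (Xi χ) := by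
  have hm : (m : ℂ) ≠ 0 := by exact_mod_cast NeZero.ne m
  have h1 : Differentiable ℂ fun z : ℂ ↦
      (m : ℂ) ^ ((1 + 2 * (parity χ : ℂ) + 2 * Complex.I * z) / 4) := fun z ↦
    DifferentiableAt.const_cpow (by fun_prop) (Or.inl hm)
  have h2 := DirichletCharacter.differentiable_completedLFunction hχ
  exact h1.mul (h2.comp (by fun_prop))

theorem completedLFunction_ne_zero_of_one_le_re (hχ : χ ≠ 1) {s : ℂ} (hs : 1 ≤ s.re) :
    χ.completedLFunction s ≠ 0 := by
  intro h
  refine DirichletCharacter.LFunction_ne_zero_of_one_le_re χ (Or.inl hχ) hs ?_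
  rw [DirichletCharacter.LFunction_eq_completed_div_gammaFactor χ s
    (Or.inl (by rintro rfl; simp at hs; linarith)), h, zero_div]

theorem completedLFunction_eq_zero_iff {s : ℂ} (hs : 0 < s.re) :
    χ.completedLFunction s = 0 ↔ χ.LFunction s = 0 := by
  have hγ : χ.gammaFactor s ≠ 0 := by
    rcases χ.even_or_odd with h | h
    · rw [h.gammaFactor_def]
      exact Complex.Gammaℝ_ne_zero_of_re_pos hs
    · rw [h.gammaFactor_def]
      exact Complex.Gammaℝ_ne_zero_of_re_pos (by simp; linarith)
  rw [DirichletCharacter.LFunction_eq_completed_div_gammaFactor χ s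
    (Or.inl (by rintro rfl; simp at hs)), div_eq_zero_iff, or_iff_left hγ]

theorem Xi_zero_ne_zero (hχ : χ ≠ 1) (hphi : ∀ t : ℝ, 0 ≤ phi χ t) : Xi χ 0 ≠ 0 := by
  obtain ⟨θ, c, hc, hθ, hM⟩ := exists_hasMellin_Xi hχ hphi
  have hM' : ∀ z, HasMellin θ ((((1 + 2 * parity χ : ℝ) : ℂ) + 2 * Complex.I * z) / 4)
      (c * Xi χ z) := by
    intro z; push_cast; exact hM z
  intro h0
  -- The point z = -i/2 corresponds to s = 1, where L(s, χ) does not vanish.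
  have h1 := mul_I_eq_zero_of_apply_zero_eq_zero hθ hM' (by simp [h0]) (-(1 / 2))
  rw [mul_eq_zero, or_iff_right (by exact_mod_cast hc.ne'), Xi_eq_zero_iff] at h1
  refine completedLFunction_ne_zero_of_one_le_re hχ ?_ h1
  have : (1 + 2 * Complex.I * (((-(1 / 2) : ℝ) : ℂ) * Complex.I)) / 2 = 1 := by
    push_cast
    linear_combination (-1 / 2 : ℂ) * Complex.I_mul_I
  rw [this]; simp

theorem inv_eq_self_of_isRealCharacter {n : ℕ} {χ : DirichletCharacter ℂ n}
    (hreal : IsRealCharacter χ) : χ⁻¹ = χ := by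
  refine MulChar.ext fun a ↦ ?_
  have h1 : χ⁻¹ a = star (χ a) := (MulChar.star_apply' χ a).symm
  rw [h1]
  exact Complex.conj_eq_iff_im.2 (hreal a)

theorem completedLFunction_one_sub_of_real (hreal : IsRealCharacter χ) (hprim : χ.IsPrimitive)
    (hχ : χ ≠ 1) (hphi : ∀ t : ℝ, 0 ≤ phi χ t) (s : ℂ) :
    χ.completedLFunction (1 - s) = (m : ℂ) ^ (s - 1 / 2) * χ.completedLFunction s := by
  have h := hprim.completedLFunction_one_sub
  rw [inv_eq_self_of_isRealCharacter hreal] at h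
  have h0 := Xi_zero_ne_zero hχ hphi
  rw [Ne, Xi_eq_zero_iff, mul_zero, add_zero] at h0
  -- At the fixed point s = 1/2 the functional equation reads Λ = W·Λ with Λ ≠ 0, so the root number
  -- W is 1.
  have h1 := h (1 / 2)
  rw [show (1 : ℂ) - 1 / 2 = 1 / 2 by norm_num, sub_self, Complex.cpow_zero, one_mul] at h1
  have hW : χ.rootNumber = 1 := (mul_eq_right₀ h0).1 h1.symm
  rw [h, hW, mul_one]

theorem Xi_neg (hreal : IsRealCharacter χ) (hprim : χ.IsPrimitive)
    (hχ : χ ≠ 1) (hphi : ∀ t : ℝ, 0 ≤ phi χ t) (z : ℂ) : Xi χ (-z) = Xi χ z := by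
  have hm : (m : ℂ) ≠ 0 := by exact_mod_cast NeZero.ne m
  have h := completedLFunction_one_sub_of_real hreal hprim hχ hphi ((1 + 2 * Complex.I * z) / 2)
  rw [Xi, Xi, show (1 + 2 * Complex.I * -z) / 2 = 1 - (1 + 2 * Complex.I * z) / 2 by ring, h,
    ← mul_assoc, ← Complex.cpow_add _ _ hm]
  congr 2
  ring

theorem half_add_I_mul_re (z : ℂ) : ((1 + 2 * Complex.I * z) / 2).re = 1 / 2 - z.im := by
  rw [show (1 + 2 * Complex.I * z) / 2 = ((1 / 2 : ℝ) : ℂ) + Complex.I * z by push_cast; ring]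
  rw [Complex.add_re, Complex.ofReal_re, Complex.I_mul_re]
  ring

theorem LFunction_eq_zero_of_Xi_eq_zero (hreal : IsRealCharacter χ) (hprim : χ.IsPrimitive)
    (hχ : χ ≠ 1) (hphi : ∀ t : ℝ, 0 ≤ phi χ t) {z : ℂ} (hz : Xi χ z = 0) :
    χ.LFunction ((1 + 2 * Complex.I * z) / 2) = 0 ∧ 0 < ((1 + 2 * Complex.I * z) / 2).re ∧
      ((1 + 2 * Complex.I * z) / 2).re < 1 := by
  have hlt : ∀ y : ℂ, Xi χ y = 0 → ((1 + 2 * Complex.I * y) / 2).re < 1 := by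
    intro y hy
    by_contra! h
    exact completedLFunction_ne_zero_of_one_le_re hχ h ((Xi_eq_zero_iff y).1 hy)
  have h1 := hlt z hz
  have h2 := hlt (-z) (by rwa [Xi_neg hreal hprim hχ hphi])
  have h3 : 0 < ((1 + 2 * Complex.I * z) / 2).re := by
    rw [half_add_I_mul_re] at h2 ⊢
    rw [Complex.neg_im] at h2
    linarith
  exact ⟨(completedLFunction_eq_zero_iff h3).1 ((Xi_eq_zero_iff z).1 hz), h3, h1⟩

theorem grh_iff (hreal : IsRealCharacter χ) (hprim : χ.IsPrimitive)
    (hχ : χ ≠ 1) (hphi : ∀ t : ℝ, 0 ≤ phi χ t) :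
    GRH χ ↔ ∀ z, Xi χ z = 0 → z.im = 0 := by
  constructor
  · intro h z hz
    obtain ⟨h1, h2, h3⟩ := LFunction_eq_zero_of_Xi_eq_zero hreal hprim hχ hphi hz
    have := h _ h1 h2 h3
    rw [half_add_I_mul_re] at this
    linarith
  · intro h s hs h0 h1
    have hz : (1 + 2 * Complex.I * (-Complex.I * (s - 1 / 2))) / 2 = s := by
      linear_combination (1 / 2 - s) * Complex.I_mul_I
    have h2 := h (-Complex.I * (s - 1 / 2)) (by
      rw [Xi_eq_zero_iff, hz]; exact (completedLFunction_eq_zero_iff h0).2 hs)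
    have h3 := half_add_I_mul_re (-Complex.I * (s - 1 / 2))
    rw [hz, h2] at h3
    linarith

/-! ### Growth of `Xi` -/

theorem exists_norm_LFunction_le (χ : DirichletCharacter ℂ m) :
    ∃ C : ℝ, ∀ s : ℂ, 2 ≤ s.re → ‖χ.LFunction s‖ ≤ C := by
  have hsum : ∀ s : ℂ, 2 ≤ s.re → Summable fun n ↦ ‖LSeries.term (χ ·) s n‖ := fun s hs ↦
    (ZMod.LSeriesSummable_of_one_lt_re χ (by linarith)).norm
  refine ⟨∑' n, ‖LSeries.term (χ ·) 2 n‖, fun s hs ↦ ?_⟩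
  rw [DirichletCharacter.LFunction_eq_LSeries χ (by linarith), LSeries]
  refine (norm_tsum_le_tsum_norm (hsum s hs)).trans ?_
  exact (hsum s hs).tsum_le_tsum
    (fun n ↦ LSeries.norm_term_le_of_re_le_re _ (by simpa using hs) n) (hsum 2 (by simp))

/-- The point is chosen to make the argument of Γ equal to n + 1, so that Γ is n!, while s = 2n + 2
- a lies where the Dirichlet series is bounded. -/
theorem exists_norm_Xi_le (hχ : χ ≠ 1) : ∃ C : ℝ, ∀ n : ℕ, 1 ≤ n →
    ‖Xi χ (-(((2 * n + 3 / 2 - parity χ : ℝ) : ℂ) * Complex.I))‖ ≤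
      Real.exp (C + (n + 1) * Real.log m + n * Real.log n) := by
  have hm0 : (0 : ℝ) < m := by exact_mod_cast Nat.pos_of_ne_zero (NeZero.ne m)
  obtain ⟨C, hC⟩ := exists_norm_LFunction_le χ
  refine ⟨Real.log (|C| + 1), fun n hn ↦ ?_⟩
  set z : ℂ := -(((2 * n + 3 / 2 - parity χ : ℝ) : ℂ) * Complex.I) with hz
  have hw : (1 + 2 * (parity χ : ℂ) + 2 * Complex.I * z) / 4 = n + 1 := by
    rw [hz]; push_cast
    linear_combination (-(2 * n + 3 / 2 - parity χ : ℂ) / 2) * Complex.I_mul_I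
  have hs : 2 ≤ ((1 + 2 * Complex.I * z) / 2).re := by
    have h1 : (1 : ℝ) ≤ n := by exact_mod_cast hn
    have h2 : (parity χ : ℝ) ≤ 1 := by
      unfold parity; split_ifs <;> simp
    rw [half_add_I_mul_re, hz]
    simp
    linarith
  rw [Xi_eq χ hχ z (by
    intro k hk
    rw [hw] at hk
    have : ((n + 1 + k : ℕ) : ℂ) = 0 := by push_cast; linear_combination hk
    exact absurd (Nat.cast_eq_zero.1 this) (by omega)), neg_div, hw, norm_mul, norm_mul,
    Complex.norm_cpow_eq_rpow_re_of_pos (by positivity), Complex.Gamma_nat_eq_factorial,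
    Complex.norm_natCast]
  have h1 : (Real.pi / m) ^ (-((n : ℂ) + 1)).re ≤ (m : ℝ) ^ (n + 1) := by
    rw [show (-((n : ℂ) + 1)).re = -((n + 1 : ℕ) : ℝ) by simp, Real.rpow_neg (by positivity),
      Real.rpow_natCast, ← inv_pow, inv_div]
    gcongr
    exact div_le_self hm0.le (by linarith [Real.pi_gt_three])
  have h2 : (n.factorial : ℝ) ≤ (n : ℝ) ^ n := by exact_mod_cast n.factorial_le_pow
  have h3 : ‖χ.LFunction ((1 + 2 * Complex.I * z) / 2)‖ ≤ |C| + 1 :=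
    (hC _ hs).trans ((le_abs_self C).trans (by linarith))
  have hn0 : (0 : ℝ) < n := by exact_mod_cast hn
  rw [Real.exp_add, Real.exp_add, Real.exp_log (by positivity),
    show ((n : ℝ) + 1) * Real.log m = Real.log m * ((n + 1 : ℕ) : ℝ) by push_cast; ring,
    show (n : ℝ) * Real.log n = Real.log n * (n : ℝ) by ring,
    ← Real.rpow_def_of_pos hm0, ← Real.rpow_def_of_pos hn0, Real.rpow_natCast, Real.rpow_natCast]
  calc _ ≤ (m : ℝ) ^ (n + 1) * (n : ℝ) ^ n * (|C| + 1) := by gcongr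
    _ = _ := by ring

open Filter Asymptotics in
theorem exists_growth_of_comp_sq (hreal : IsRealCharacter χ) (hprim : χ.IsPrimitive)
    (hχ : χ ≠ 1) (hphi : ∀ t : ℝ, 0 ≤ phi χ t) {F : ℂ → ℂ} {ρ : ℝ} (hρ : 0 < ρ)
    (hF : ∀ z, F (z ^ 2) = Xi χ (ρ * z)) :
    ∃ R M : ℕ → ℝ, Tendsto R atTop atTop ∧ (∀ n z, ‖z‖ ≤ 2 * R n → ‖F z‖ ≤ Real.exp (M n)) ∧
      Tendsto (fun n ↦ M n / R n) atTop (𝓝 0) := by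
  obtain ⟨C, hC⟩ := exists_norm_Xi_le hχ
  obtain ⟨θ, c, hc, hθ, hM⟩ := exists_hasMellin_Xi hχ hphi
  have hM' : ∀ z, HasMellin θ ((((1 + 2 * parity χ : ℝ) : ℂ) + 2 * Complex.I * z) / 4)
      (c * Xi χ z) := by
    intro z; push_cast; exact hM z
  have ha : (parity χ : ℝ) ≤ 1 := by
    unfold parity; split_ifs <;> simp
  set r : ℕ → ℝ := fun n ↦ 2 * (n + 1 : ℕ) + 3 / 2 - parity χ with hr
  have hr0 : ∀ n, 2 * ((n + 1 : ℕ) : ℝ) ≤ r n := fun n ↦ by simp only [hr]; linarith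
  have hrpos : ∀ n, 0 < r n := fun n ↦ lt_of_lt_of_le (by positivity) (hr0 n)
  set M : ℕ → ℝ := fun n ↦ Real.log 2 + (C + ((n + 1 : ℕ) + 1) * Real.log m +
    (n + 1 : ℕ) * Real.log (n + 1 : ℕ)) with hMdef
  -- With this choice |y²| ≤ 2 R n is equivalent to |ρy| ≤ r n. Then M n is O(n log n) while R n
  -- grows like n²; the log 2 in M n accounts for the two edges of the strip, on which Ξ agrees by
  -- evenness.
  set R : ℕ → ℝ := fun n ↦ r n ^ 2 / (2 * ρ ^ 2) with hR
  have hsq : (fun n : ℕ ↦ ((n + 1 : ℕ) : ℝ) ^ 2) =O[atTop] R := by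
    refine IsBigO.of_bound (2 * ρ ^ 2) (Eventually.of_forall fun n ↦ ?_)
    have h1 : ((n + 1 : ℕ) : ℝ) ^ 2 ≤ r n ^ 2 := by
      have := hr0 n
      have h2 : (0 : ℝ) ≤ ((n + 1 : ℕ) : ℝ) := by positivity
      gcongr
      linarith
    rw [Real.norm_of_nonneg (by positivity), Real.norm_of_nonneg (by simp only [hR]; positivity)]
    simp only [hR]
    rw [mul_div_cancel₀ _ (by positivity)]
    exact h1
  have hnat : Tendsto (fun n : ℕ ↦ ((n + 1 : ℕ) : ℝ)) atTop atTop :=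
    tendsto_natCast_atTop_atTop.comp (tendsto_add_atTop_nat 1)
  have hlin : (fun n : ℕ ↦ ((n + 1 : ℕ) : ℝ)) =o[atTop] fun n : ℕ ↦ ((n + 1 : ℕ) : ℝ) ^ 2 := by
    have := (isLittleO_pow_pow_atTop_of_lt (𝕜 := ℝ) one_lt_two).comp_tendsto hnat
    simpa [Function.comp_def] using this
  have hone : ∀ K : ℝ, (fun _ : ℕ ↦ K) =o[atTop] fun n : ℕ ↦ ((n + 1 : ℕ) : ℝ) ^ 2 := by
    intro K
    refine isLittleO_const_left.2 (Or.inr ?_)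
    exact tendsto_norm_atTop_atTop.comp ((tendsto_pow_atTop two_ne_zero).comp hnat)
  have hlog : (fun n : ℕ ↦ ((n + 1 : ℕ) : ℝ) * Real.log (n + 1 : ℕ)) =o[atTop]
      fun n : ℕ ↦ ((n + 1 : ℕ) : ℝ) ^ 2 := by
    have := (isBigO_refl (fun n : ℕ ↦ ((n + 1 : ℕ) : ℝ)) atTop).mul_isLittleO
      (Real.isLittleO_log_id_atTop.comp_tendsto hnat)
    simpa [Function.comp_def, sq] using this
  refine ⟨R, M, ?_, fun n z hz ↦ ?_, ?_⟩
  · have h1 : Tendsto r atTop atTop := by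
      refine tendsto_atTop_mono hr0 (hnat.const_mul_atTop two_pos)
    exact ((tendsto_pow_atTop two_ne_zero).comp h1).atTop_div_const (by positivity)
  · obtain ⟨y, rfl⟩ := IsSquare.exists_sq z ⟨z ^ (1 / 2 : ℂ), by
      rw [← sq]; simp⟩
    rw [hF]
    have h1 : ‖(ρ * y : ℂ)‖ ≤ r n := by
      rw [norm_mul, Complex.norm_real, Real.norm_of_nonneg hρ.le]
      refine le_of_sq_le_sq ?_ (hrpos n).le
      rw [norm_pow] at hz
      simp only [hR] at hz
      rw [mul_pow]
      calc ρ ^ 2 * ‖y‖ ^ 2 ≤ ρ ^ 2 * (2 * (r n ^ 2 / (2 * ρ ^ 2))) := by gcongr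
        _ = r n ^ 2 := by field_simp
    have h2 := norm_le_norm_add_norm hθ hM' ((Complex.abs_im_le_norm _).trans h1)
    rw [norm_mul, norm_mul, norm_mul, ← mul_add] at h2
    have hc' : 0 < ‖(c : ℂ)‖ := norm_pos_iff.2 (by exact_mod_cast hc.ne')
    have h3 := le_of_mul_le_mul_left h2 hc'
    rw [← Xi_neg hreal hprim hχ hphi ((r n : ℂ) * Complex.I)] at h3
    have h4 := hC (n + 1) (by omega)
    simp only [hMdef]
    rw [Real.exp_add, Real.exp_log two_pos]
    calc _ ≤ _ := h3
      _ = 2 * ‖Xi χ (-((r n : ℂ) * Complex.I))‖ := by ring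
      _ ≤ _ := by
        gcongr
  · refine IsLittleO.tendsto_div_nhds_zero (IsLittleO.trans_isBigO ?_ hsq)
    simp only [hMdef, add_mul]
    refine (hone _).add (((hone _).add ((?_ : _ =o[atTop] _).add (hone _))).add hlog)
    simpa [mul_comm] using hlin.const_mul_left (Real.log m)

/-! ### The quotient -/

/-- Differentiating F(z²) = Ξ(ρz) gives 2z F'(z²) = ρ Ξ'(ρz), and √z cancels. The right side is
continuous at 0, so it also gives the limit there. -/
theorem quotient_eq {F : ℂ → ℂ} (hF : Differentiable ℂ F) {ρ : ℝ} (hρ : 0 < ρ) (hF0 : F 0 ≠ 0)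
    (hXi : Differentiable ℂ (Xi χ)) (hFX : ∀ z, F (z ^ 2) = Xi χ (ρ * z)) :
    quotient χ ρ = fun z ↦ (2 / ρ : ℂ) * logDeriv F z := by
  have hρc : (ρ : ℂ) ≠ 0 := by exact_mod_cast hρ.ne'
  have hsq : ∀ z : ℂ, (z ^ (1 / 2 : ℂ)) ^ 2 = z := by intro z; simp
  have hd : ∀ z : ℂ, 2 * z * deriv F (z ^ 2) = ρ * deriv (Xi χ) (ρ * z) := by
    intro z
    have h1 : HasDerivAt (fun z ↦ F (z ^ 2)) (deriv F (z ^ 2) * (2 * z)) z := by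
      have := (hF (z ^ 2)).hasDerivAt.comp z (hasDerivAt_pow 2 z)
      simpa [Function.comp_def] using this
    have h2 : HasDerivAt (fun z ↦ Xi χ (ρ * z)) (deriv (Xi χ) (ρ * z) * ρ) z := by
      have := (hXi (ρ * z)).hasDerivAt.comp z ((hasDerivAt_id z).const_mul (ρ : ℂ))
      simpa [Function.comp_def] using this
    rw [← funext hFX] at h2
    linear_combination h1.unique h2
  have hraw : ∀ z : ℂ, z ≠ 0 → rawQuotient χ ρ z = (2 / ρ : ℂ) * logDeriv F z := by
    intro z hz
    have h0 : z ^ (1 / 2 : ℂ) ≠ 0 := by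
      intro h; apply hz; rw [← hsq z, h]; simp
    have h1 := hd (z ^ (1 / 2 : ℂ))
    rw [hsq] at h1
    rw [rawQuotient, ← hFX, hsq, logDeriv_apply]
    have h2 : deriv (Xi χ) (ρ * z ^ (1 / 2 : ℂ)) = 2 * z ^ (1 / 2 : ℂ) * deriv F z / ρ := by
      rw [eq_div_iff hρc]; linear_combination -h1
    rw [h2, div_div, mul_assoc 2, mul_comm _ (deriv F z), ← mul_assoc,
      show (ρ : ℂ) * (z ^ (1 / 2 : ℂ) * F z) = (ρ * F z) * z ^ (1 / 2 : ℂ) by ring,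
      mul_div_mul_right _ _ h0, mul_div_mul_comm]
  have hlim : Filter.Tendsto (rawQuotient χ ρ) (𝓝[≠] 0) (𝓝 ((2 / ρ : ℂ) * logDeriv F 0)) := by
    have hc : ContinuousAt (fun z ↦ (2 / ρ : ℂ) * logDeriv F z) 0 :=
      (analyticAt_logDeriv hF hF0).continuousAt.const_mul _
    refine (hc.tendsto.mono_left nhdsWithin_le_nhds).congr' ?_
    filter_upwards [self_mem_nhdsWithin] with z hz using (hraw z hz).symm
  ext z
  rcases eq_or_ne z 0 with rfl | hz
  · rw [quotient, Function.update_self, hlim.limUnder_eq]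
  · rw [quotient, Function.update_of_ne hz, hraw z hz]

theorem iteratedDeriv_quotient_nonpos_iff {F : ℂ → ℂ} {ρ : ℝ} (hρ : 0 < ρ)
    (hq : quotient χ ρ = fun z ↦ (2 / ρ : ℂ) * logDeriv F z) (j k : ℕ) :
    iteratedDeriv (j + k) (fun z : ℂ ↦ (z - 1) ^ j * quotient χ ρ z) 0 ≤ 0 ↔
      iteratedDeriv (j + k) (fun z : ℂ ↦ (z - 1) ^ j * logDeriv F z) 0 ≤ 0 := by
  have h1 : (fun z : ℂ ↦ (z - 1) ^ j * quotient χ ρ z) =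
      fun z ↦ ((2 / ρ : ℝ) : ℂ) * ((z - 1) ^ j * logDeriv F z) := by
    ext z; rw [hq]; push_cast; ring
  have h2 : (0 : ℝ) < 2 / ρ := by positivity
  rw [h1, iteratedDeriv_const_mul_field, Complex.le_def, Complex.le_def, Complex.re_ofReal_mul,
    Complex.im_ofReal_mul, Complex.zero_re, Complex.zero_im, mul_eq_zero, or_iff_right h2.ne',
    ← mul_zero (2 / ρ), mul_le_mul_iff_right₀ h2, mul_zero]

end

end CharacterXi

/-! ### The equivalence -/

open CharacterXi

theorem corollary3p6 (m : ℕ) [NeZero m] (χ : DirichletCharacter ℂ m)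
    (hreal : CharacterXi.IsRealCharacter χ) (hprim : χ.IsPrimitive) (hχ : χ ≠ 1)
    (hphi : ∀ t : ℝ, 0 ≤ CharacterXi.phi χ t) :
    CharacterXi.GRH χ ↔
      ∃ ρ : ℝ, 0 < ρ ∧
        (ρ : EReal) ≤ ⨅ z ∈ {z : ℂ | CharacterXi.Xi χ z = 0}, (‖z‖ : EReal) ∧
        ∀ j k : ℕ,
          iteratedDeriv (j + k)
            (fun z : ℂ => (z - 1) ^ j * CharacterXi.quotient χ ρ z) 0 ≤ 0 := by
  have hXi := differentiable_Xi hχ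
  have hX0 := Xi_zero_ne_zero hχ hphi
  have hex : ∀ ρ : ℝ, 0 < ρ → ∃ F : ℂ → ℂ, Differentiable ℂ F ∧ F 0 ≠ 0 ∧
      (∀ z, F (z ^ 2) = Xi χ (ρ * z)) ∧
      quotient χ ρ = fun z ↦ (2 / ρ : ℂ) * logDeriv F z := by
    intro ρ hρ
    obtain ⟨F, hF, hFX⟩ := exists_differentiable_comp_sq (H := fun z ↦ Xi χ (ρ * z))
      (hXi.comp (by fun_prop)) fun z ↦ by
        rw [mul_neg, Xi_neg hreal hprim hχ hphi]
    have hF0 : F 0 ≠ 0 := by 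
      have := hFX 0
      simp only [ne_eq, OfNat.ofNat_ne_zero, not_false_eq_true, zero_pow, mul_zero] at this
      rwa [this]
    exact ⟨F, hF, hF0, hFX, quotient_eq hF hρ hF0 hXi hFX⟩
  rw [grh_iff hreal hprim hχ hphi]
  constructor
  · intro hgrh
    -- Any zero-free disc about 0 supplies an admissible ρ.
    obtain ⟨ρ, hρ, hball⟩ := Metric.eventually_nhds_iff_ball.1
      (hXi.continuous.continuousAt.eventually_ne hX0)
    have hle : ∀ z, Xi χ z = 0 → ρ ≤ ‖z‖ := by
      intro z hz
      by_contra! h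
      exact hball z (by simpa using h) hz
    refine ⟨ρ, hρ, le_iInf₂ fun z hz ↦ by exact_mod_cast hle z hz, fun j k ↦ ?_⟩
    obtain ⟨F, hF, hF0, hFX, hq⟩ := hex ρ hρ
    obtain ⟨R, M, hR, hM, hMR⟩ := exists_growth_of_comp_sq hreal hprim hχ hphi hρ hFX
    rw [iteratedDeriv_quotient_nonpos_iff hρ hq]
    refine iteratedDeriv_nonpos_of_zeros hF hF0 (fun w hw ↦ ?_) hR hM hMR j k
    obtain ⟨y, rfl⟩ := IsSquare.exists_sq w ⟨w ^ (1 / 2 : ℂ), by rw [← sq]; simp⟩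
    rw [hFX] at hw
    have him := hgrh _ hw
    have hnorm := hle _ hw
    rw [Complex.im_ofReal_mul, mul_eq_zero, or_iff_right hρ.ne'] at him
    have hy : y = (y.re : ℂ) := Complex.ext rfl (by simpa using him)
    rw [norm_mul, Complex.norm_real, Real.norm_of_nonneg hρ.le, le_mul_iff_one_le_right hρ, hy,
      Complex.norm_real, Real.norm_eq_abs] at hnorm
    refine ⟨y.re ^ 2, (one_le_sq_iff_one_le_abs _).2 hnorm, ?_⟩
    rw [Complex.ofReal_pow, ← hy]
  · rintro ⟨ρ, hρ, -, hsign⟩ z hz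
    obtain ⟨F, hF, hF0, hFX, hq⟩ := hex ρ hρ
    have hρc : (ρ : ℂ) ≠ 0 := by exact_mod_cast hρ.ne'
    obtain ⟨x, hx1, hx⟩ := exists_one_le_of_iteratedDeriv_nonpos hF hF0
      (fun j k ↦ (iteratedDeriv_quotient_nonpos_iff hρ hq j k).1 (hsign j k))
      (w := (z / ρ) ^ 2) (by rw [hFX, mul_div_cancel₀ _ hρc, hz])
    have hre : z ^ 2 = ((ρ ^ 2 * x : ℝ) : ℂ) := by
      rw [div_pow, div_eq_iff (pow_ne_zero 2 hρc)] at hx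
      rw [hx]; push_cast; ring
    have h1 := congrArg Complex.re hre
    have h2 := congrArg Complex.im hre
    rw [Complex.ofReal_re, sq, Complex.mul_re] at h1
    rw [Complex.ofReal_im, sq, Complex.mul_im] at h2
    have h3 : 0 < ρ ^ 2 * x := by positivity
    -- As z² is real and positive, Im z ≠ 0 would give Re z = 0 and z² ≤ 0.
    by_contra him
    have h4 : z.re = 0 := by
      have : z.re * z.im = 0 := by linarith
      exact (mul_eq_zero.1 this).resolve_right him
    rw [h4] at h1
    nlinarith [sq_nonneg z.im]
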